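/- Throughout, rings are commutative, Noetherian and have an identity. Let $R$ be a ring, $\mathfrak a$ a proper ideal of $R$ and $M$ a finitely generated $R$-module. For $i\ge 0$ put $H^i_{\mathfrak a}(M)=\varinjlim_n \operatorname{Ext}^i_R(R/\mathfrak a^n,M)$, and let $\operatorname{cd}(\mathfrak a,M)=\sup\{i : H^i_{\mathfrak a}(M)\neq 0\}$ (with $\sup\emptyset=-\infty$). If $M\ne\mathfrak aM$, let $\operatorname{grade}(\mathfrak a,M)$ be the supremum of the lengths of $M$-regular sequences contained in $\mathfrak a$; if $M=\mathfrak aM$, put $\operatorname{grade}(\mathfrak a,M)=\infty$. If $M\neq\mathfrak aM$, a sequence $x_1,\dots,x_c\in\mathfrak a$ with $c=\operatorname{cd}(\mathfrak a,M)$ is an $\mathfrak a$-relative system of parameters ($\mathfrak a$-s.o.p.) of $M$ if $\operatorname{Rad}(\langle x_1,\dots,x_c\rangle+\operatorname{Ann}_RM)=\operatorname{Rad}(\mathfrak a+\operatorname{Ann}_RM)$. - $M$ is $\mathfrak a$-relative Cohen–Macaulay if either $M=\mathfrak aM$, or $M\ne\mathfrak aM$ and $\operatorname{grade}(\mathfrak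 a,M)=\operatorname{cd}(\mathfrak a,M)$. - $M$ is $\mathfrak a$-relative maximal Cohen–Macaulay if $\operatorname{grade}(\mathfrak a,M)=\operatorname{cd}(\mathfrak a,R)$. - $M$ is $\mathfrak a$-relative Gorenstein if $\operatorname{Ext}^i_R(R/\mathfrak a,M)=0$ for all $i\ne\operatorname{cd}(\mathfrak a,R)$. - $M$ is $\mathfrak a$-relative regular if either $M=\mathfrak aM$, or $M\neq\mathfrak aM$ and $\mathfrak a$ can be generated by an $M$-regular sequence of length $\operatorname{cd}(\mathfrak a,R)$ which is also an $R$-regular sequence. - Let $\mathcal R$ be the $\mathfrak a$-adic completion of $R$. The ring $R$ is $\mathfrak a$-relative complete intersection if there are a ring $T$, a proper ideal $\mathfrak b$ of $T$ and elements $x_1,\dots,x_\ell\in\mathfrak b$ such that $x_1,\dots,x_\ell$ is both part of a $\mathfrak b$-s.o.p. of $T$ and a $T$-regular sequence, $T$ is $\mathfrak b$-relative regular, and there is a ring isomorphism $T/\langle x_1,\dots,x_\ell\rangle\cong\mathcal R$ under which $\mathfrak b\mathcal R=\mathfrak a\mathcal R$. The ring $R$ is called $\mathfrak a$-relative regular (Gorenstein,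 etc.) if it is so as a module over itself. **Theorem 2.19.** Let $\mathfrak a$ be a proper ideal of $R$. (i) Suppose that $\mathfrak a$ is contained in the Jacobson radical of $R$. If $R$ is $\mathfrak a$-relative regular, then it is $\mathfrak a$-relative complete intersection. (ii) Suppose that $\mathfrak a$ is contained in the Jacobson radical of $R$. If $R$ is $\mathfrak a$-relative complete intersection, then it is $\mathfrak a$-relative Gorenstein. (iii) Every finitely generated $\mathfrak a$-relative Gorenstein $R$-module $M$ with $M\neq\mathfrak aM$ is $\mathfrak a$-relative maximal Cohen–Macaulay. (iv) Every finitely generated $\mathfrak a$-relative maximal Cohen–Macaulay $R$-module is $\mathfrak a$-relative Cohen–Macaulay. -/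

import Mathlib

universe u

open CategoryTheory

noncomputable section

namespace RelHom

/-- The cohomological dimension `cd(a, M)`: the supremum of the integers `i` with `H_a^i(M) ≠ 0`,
where `H_a^i(M)` is the colimit of the modules `Ext_R^i(R/a^n, M)`.
It is `⊥` (that is, `-∞`) if all local cohomology modules vanish. -/
def cd {R : Type u} [CommRing R] (a : Ideal R) (M : Type u) [AddCommGroup M] [Module R M] :
    WithBot ℕ∞ :=
  sSup {n | ∃ i : ℕ, Nontrivial ((localCohomology a i).obj (ModuleCat.of R M)) ∧
    n = (i : WithBot ℕ∞)}

open Classical in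
/-- The grade of `a` on `M`: the supremum of the lengths of the `M`-regular sequences in `a`,
with the usual convention that it is `∞` if `M = aM`. -/
def grade {R : Type u} [CommRing R] (a : Ideal R) (M : Type u) [AddCommGroup M] [Module R M] :
    ℕ∞ :=
  if a • (⊤ : Submodule R M) = ⊤ then ⊤
  else sSup {n | ∃ rs : List R, RingTheory.Sequence.IsRegular M rs ∧ (∀ x ∈ rs, x ∈ a) ∧
    n = (rs.length : ℕ∞)}

/-- `M` is `a`-relative Cohen–Macaulay (used for finitely generated `M`). -/
def IsRelCohenMacaulay {R : Type u} [CommRing R] (a : Ideal R)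
    (M : Type u) [AddCommGroup M] [Module R M] : Prop :=
  a • (⊤ : Submodule R M) = ⊤ ∨
    (a • (⊤ : Submodule R M) ≠ ⊤ ∧ (grade a M : WithBot ℕ∞) = cd a M)

/-- `rs` is an `a`-relative system of parameters of `M`. -/
def IsRelSOP {R : Type u} [CommRing R] (a : Ideal R)
    (M : Type u) [AddCommGroup M] [Module R M] (rs : List R) : Prop :=
  a • (⊤ : Submodule R M) ≠ ⊤ ∧
    (∀ x ∈ rs, x ∈ a) ∧
    (rs.length : WithBot ℕ∞) = cd a M ∧
    (Ideal.ofList rs ⊔ Module.annihilator R M).radical = (a ⊔ Module.annihilator R M).radical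

/-- `M` is `a`-relative regular (used for finitely generated `M`). -/
def IsRelRegular {R : Type u} [CommRing R] (a : Ideal R)
    (M : Type u) [AddCommGroup M] [Module R M] : Prop :=
  a • (⊤ : Submodule R M) = ⊤ ∨
    (a • (⊤ : Submodule R M) ≠ ⊤ ∧
      ∃ rs : List R, Ideal.ofList rs = a ∧
        (rs.length : WithBot ℕ∞) = cd a R ∧
        RingTheory.Sequence.IsRegular M rs ∧
        RingTheory.Sequence.IsRegular R rs)

/-- The ring `R` is `a`-relative complete intersection. Here `xs` is part of a `b`-relative
system of parameters of `T` if it can be completed to one by a list `ys`. The last condition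
compares the extensions of `b` (along `T → T/(xs) ≅ R^`) and of `a` to the `a`-adic
completion `R^` of `R`. -/
def IsRelCompleteIntersection (R : Type u) [CommRing R] (a : Ideal R) : Prop :=
  ∃ (T : Type u) (_ : CommRing T) (_ : IsNoetherianRing T) (b : Ideal T) (xs : List T)
    (e : (T ⧸ Ideal.ofList xs) ≃+* AdicCompletion a R),
    b ≠ ⊤ ∧
    (∀ x ∈ xs, x ∈ b) ∧
    (∃ ys : List T, IsRelSOP b T (xs ++ ys)) ∧
    RingTheory.Sequence.IsRegular T xs ∧
    IsRelRegular b T ∧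
    b.map ((e : (T ⧸ Ideal.ofList xs) →+* AdicCompletion a R).comp
      (Ideal.Quotient.mk (Ideal.ofList xs))) = a.map (algebraMap R (AdicCompletion a R))

/-- `M` is `a`-relative Gorenstein (used for finitely generated `M`). -/
def IsRelGorenstein {R : Type u} [CommRing R] (a : Ideal R)
    (M : Type u) [AddCommGroup M] [Module R M] : Prop :=
  ∀ i : ℕ, (i : WithBot ℕ∞) ≠ cd a R →
    Subsingleton (Abelian.Ext (ModuleCat.of R (R ⧸ a)) (ModuleCat.of R M) i)

/-- `M` is `a`-relative maximal Cohen–Macaulay (used for finitely generated `M`). -/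
def IsRelMaximalCohenMacaulay {R : Type u} [CommRing R] (a : Ideal R)
    (M : Type u) [AddCommGroup M] [Module R M] : Prop :=
  (grade a M : WithBot ℕ∞) = cd a R

end RelHom

end

/-! For finitely generated `M` with `M ≠ aM`, the grade is the least `i` with Ext^i(R/a, M) ≠ 0
(`exists_grade_eq`). In that degree Ext injects into local cohomology, so grade(a, M) ≤ cd(a, M)
(`grade_le_cd`). Also cd(a, M) ≤ cd(a, R) (`isEffaceable_finite_of_ring`). If grade(a, M) = cd(a,
R), these inequalities collapse, which is (iv). If M is relative Gorenstein, cd(a, R) is the only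
degree where Ext can be nonzero, so it is the grade, which is (iii).

For (i), the completion itself serves as T, with no relations: a regular sequence generating `a`
stays regular under the flat map to the completion, which is Noetherian.

For (ii), let b = (rs) with `rs` regular in T. Then Ext_T^j(T/b, T) vanishes for j ≠ |rs|. Rees's
change of rings lowers degrees by |xs| on passing to T/(xs) ≅ R^, and faithfully flat descent brings
the vanishing to R. So Ext_R^i(R/a, R) = 0 unless i = |rs| - |xs|, which is then the grade.
Completing `xs` by `ys` to a system of parameters of length |rs|, the images of `ys` can be
approximated in R by elements generating `a` up to radical. Hence cd(a, R) ≤ |ys| = |rs| - |xs|, and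
grade ≤ cd gives equality.

Local cohomology enters only through `IsEffaceable`: H^i_a(M) = 0 iff every class over R/J dies over
some R/J'. Working with classes gives directly that each extra generator raises the bound on cd by
at most one (`IsEffaceable.sup_span`). -/

noncomputable section

namespace RelHom

/-! ### Vanishing of local cohomology in terms of Ext classes -/

section ExtComparison

variable {R : Type u} [CommRing R]

open Abelian HomologicalComplex

/-- The chain complex in the opposite category computing `Ext(N, M)` from a projective resolution
of `N`. -/
abbrev homComplex {N : ModuleCat.{u} R} (P : ProjectiveResolution N) (M : ModuleCat.{u} R) :
    ChainComplex (ModuleCat.{u} R)ᵒᵖ ℕ :=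
  (((linearYoneda R (ModuleCat.{u} R)).obj M).rightOp.mapHomologicalComplex _).obj P.complex

/-- The cocycle `f` represents the class `α` in the derived functor `Ext`. -/
def Represents {N M : ModuleCat.{u} R} {i : ℕ} (P : ProjectiveResolution N)
    (f : P.complex.X i ⟶ M) (α : ((Ext R (ModuleCat.{u} R) i).obj (Opposite.op N)).obj M) : Prop :=
  ∃ w : ((homComplex P M).opcycles i).unop,
    ((homComplex P M).pOpcycles i).unop w = f ∧
    (P.isoLeftDerivedObj ((linearYoneda R (ModuleCat.{u} R)).obj M).rightOp i).hom.unop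
      (((homComplex P M).homologyι i).unop w) = α

theorem Represents.exists_rep {N M : ModuleCat.{u} R} {i : ℕ} (P : ProjectiveResolution N)
    (α : ((Ext R (ModuleCat.{u} R) i).obj (Opposite.op N)).obj M) :
    ∃ f : P.complex.X i ⟶ M, P.complex.d (i + 1) i ≫ f = 0 ∧ Represents P f α := by
  let K := homComplex P M
  let e := P.isoLeftDerivedObj ((linearYoneda R (ModuleCat.{u} R)).obj M).rightOp i
  have h1 : Function.Surjective (K.homologyι i).unop :=
    (ModuleCat.epi_iff_surjective _).1 inferInstance
  obtain ⟨w, hw⟩ := h1 (e.inv.unop α)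
  refine ⟨(K.pOpcycles i).unop w, ?_, w, rfl, ?_⟩
  · have h := congrArg (fun g => g.unop w) (K.d_pOpcycles (i + 1) i)
    exact h
  · change e.hom.unop ((K.homologyι i).unop w) = α
    rw [hw]
    exact congrArg (fun g => g.unop α) e.hom_inv_id

theorem Represents.exists_class {N M : ModuleCat.{u} R} {i : ℕ} (P : ProjectiveResolution N)
    (f : P.complex.X i ⟶ M) (hf : P.complex.d (i + 1) i ≫ f = 0) :
    ∃ α : ((Ext R (ModuleCat.{u} R) i).obj (Opposite.op N)).obj M, Represents P f α := by
  let K := homComplex P M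
  have hex : (ShortComplex.mk _ _ (K.d_pOpcycles (i + 1) i)).Exact :=
    ShortComplex.exact_of_g_is_cokernel _ (K.opcyclesIsCokernel (i + 1) i (by simp))
  have h2 := (ShortComplex.moduleCat_exact_iff _).1 hex.unop
  obtain ⟨w, hw⟩ := h2 f hf
  exact ⟨_, w, hw, rfl⟩

/-- A class vanishes iff its cocycle is a coboundary. Using `next i` covers degree 0 as well: there
the differential is zero, so the condition becomes `f = 0`. -/
theorem Represents.eq_zero_iff {N M : ModuleCat.{u} R} {i : ℕ} {P : ProjectiveResolution N}
    {f : P.complex.X i ⟶ M} {α : ((Ext R (ModuleCat.{u} R) i).obj (Opposite.op N)).obj M}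
    (h : Represents P f α) : 
    α = 0 ↔ ∃ g : P.complex.X ((ComplexShape.down ℕ).next i) ⟶ M,
      P.complex.d i ((ComplexShape.down ℕ).next i) ≫ g = f := by
  let K := homComplex P M
  let j := (ComplexShape.down ℕ).next i
  let e := P.isoLeftDerivedObj ((linearYoneda R (ModuleCat.{u} R)).obj M).rightOp i
  obtain ⟨w, hw, rfl⟩ := h
  have hex : (ShortComplex.mk _ _ (K.homologyι_comp_fromOpcycles i j)).Exact :=
    ShortComplex.exact_of_f_is_kernel _ (K.homologyIsKernel i j rfl)
  have h2 := (ShortComplex.moduleCat_exact_iff _).1 hex.unop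
  have hinj : Function.Injective ((K.pOpcycles i).unop) :=
    (ModuleCat.mono_iff_injective _).1 inferInstance
  constructor
  · intro h0
    have h3 : (K.homologyι i).unop w = 0 := by
      have := congrArg (fun g => g.unop ((K.homologyι i).unop w)) e.inv_hom_id
      refine Eq.trans this.symm ?_
      change e.inv.unop (e.hom.unop ((K.homologyι i).unop w)) = 0
      rw [show e.hom.unop ((K.homologyι i).unop w) = 0 from h0]
      exact map_zero _
    obtain ⟨g, hg⟩ := h2 w h3
    refine ⟨g, ?_⟩
    rw [← hw, ← hg]
    exact (congrArg (fun k => k.unop g) (K.p_fromOpcycles i j)).symm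
  · rintro ⟨g, hg⟩
    have : w = (K.fromOpcycles i j).unop g := by
      apply hinj
      refine hw.trans (hg.symm.trans ?_)
      exact (congrArg (fun k => k.unop g) (K.p_fromOpcycles i j)).symm
    rw [this]
    have h4 : (K.homologyι i).unop ((K.fromOpcycles i j).unop g) = 0 :=
      congrArg (fun k => k.unop g) (K.homologyι_comp_fromOpcycles i j)
    change e.hom.unop ((K.homologyι i).unop ((K.fromOpcycles i j).unop g)) = 0
    rw [h4]
    exact map_zero _

theorem Represents.naturality {N N' M : ModuleCat.{u} R} {i : ℕ} {P : ProjectiveResolution N}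
    {P' : ProjectiveResolution N'} {k : N' ⟶ N} (φ : ProjectiveResolution.Hom P' P k)
    {f : P.complex.X i ⟶ M} {α : ((Ext R (ModuleCat.{u} R) i).obj (Opposite.op N)).obj M}
    (h : Represents P f α) :
    Represents P' (φ.hom.f i ≫ f) (((Ext R (ModuleCat.{u} R) i).map k.op).app M α) := by
  obtain ⟨w, hw, rfl⟩ := h
  let G := ((linearYoneda R (ModuleCat.{u} R)).obj M).rightOp
  let ψ := (G.mapHomologicalComplex (ComplexShape.down ℕ)).map φ.hom
  refine ⟨(opcyclesMap ψ i).unop w, ?_, ?_⟩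
  · have := congrArg (fun g => g.unop w) (p_opcyclesMap ψ i)
    refine Eq.trans this ?_
    rw [← hw]
    rfl
  · have h1 := congrArg (fun g => g.unop w) (homologyι_naturality ψ i)
    have h2 := P'.isoLeftDerivedObj_hom_naturality k P φ.hom
      (by simpa using φ.hom_f_zero_comp_π_f_zero) G i
    have h3 := congrArg (fun g => g.unop (((homComplex P M).homologyι i).unop w)) h2
    refine Eq.trans ?_ h3.symm
    change (P'.isoLeftDerivedObj G i).hom.unop _ = (P'.isoLeftDerivedObj G i).hom.unop _
    congr 1
    exact h1.symm

/-- The same coboundary criterion as `Represents.eq_zero_iff`, now for `Abelian.Ext`; this match is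
what links the two versions of Ext. -/
theorem extMk_eq_zero_iff_next {N M : ModuleCat.{u} R} {i : ℕ} (P : ProjectiveResolution N)
    (f : P.complex.X i ⟶ M) (hf : P.complex.d (i + 1) i ≫ f = 0) :
    P.extMk f (i + 1) rfl hf = 0 ↔
      ∃ g : P.complex.X ((ComplexShape.down ℕ).next i) ⟶ M,
        P.complex.d i ((ComplexShape.down ℕ).next i) ≫ g = f := by
  rcases i with _ | p
  · constructor
    · intro h
      rw [← P.extEquivCohomologyClass.apply_eq_iff_eq,
        ProjectiveResolution.extEquivCohomologyClass_extMk,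
        ProjectiveResolution.extEquivCohomologyClass_zero,
        CochainComplex.HomComplex.CohomologyClass.mk_eq_zero_iff,
        CochainComplex.HomComplex.Cocycle.toSingleMk_mem_coboundaries_iff _ _ _ _ _ 1 (by simp)] at h
      obtain ⟨g, hg⟩ := h
      have hz : P.cochainComplex.d (-((0 : ℕ) : ℤ)) 1 = 0 := by
        apply Limits.IsZero.eq_of_tgt
        exact CochainComplex.isZero_of_isStrictlyLE P.cochainComplex 0 1 (by lia)
      rw [hz, Limits.zero_comp] at hg
      have : f = 0 := by
        rw [← cancel_epi (P.cochainComplexXIso (-((0 : ℕ) : ℤ)) 0 rfl).hom]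
        simpa using hg.symm
      exact ⟨0, by simp [this]⟩
    · rintro ⟨g, hg⟩
      have : f = 0 := by
        rw [← hg, P.complex.shape _ _ (by simp), Limits.zero_comp]
      subst this
      exact P.extMk_zero _ _
  · rw [P.extMk_eq_zero_iff f (p + 2) rfl hf p rfl]
    have : (ComplexShape.down ℕ).next (p + 1) = p := by simp
    rw [this]

/-- The canonical surjection `R/J' → R/J` for `J' ≤ J`. -/
abbrev quotFactor {J' J : Ideal R} (h : J' ≤ J) :
    ModuleCat.of R (R ⧸ J') ⟶ ModuleCat.of R (R ⧸ J) :=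
  ModuleCat.ofHom (Submodule.mapQ J' J LinearMap.id h)

/-- Every class in `Ext^i(R/J, M)`, for `J` with radical containing `a`, dies in `Ext^i(R/J', M)`
for some smaller `J'` of this kind. -/
def IsEffaceable (a : Ideal R) (M : ModuleCat.{u} R) (i : ℕ) : Prop :=
  ∀ (J : Ideal R), a ≤ J.radical → ∀ α : Abelian.Ext (ModuleCat.of R (R ⧸ J)) M i,
    ∃ (J' : Ideal R) (h : J' ≤ J), a ≤ J'.radical ∧
      (Ext.mk₀ (quotFactor h)).comp α (zero_add i) = 0

/-- The projective lift of a morphism, as a morphism of resolutions. -/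
def liftHom {N N' : ModuleCat.{u} R} (P : ProjectiveResolution N) (P' : ProjectiveResolution N')
    (k : N' ⟶ N) : ProjectiveResolution.Hom P' P k where
  hom := ProjectiveResolution.lift k P' P
  hom_f_zero_comp_π_f_zero :=
    ProjectiveResolution.lift_commutes_zero k P' P

/-- Both sides say that one and the same pulled-back cocycle is a coboundary, so no natural
isomorphism between the two Ext functors has to be built. -/
theorem precomp_eq_zero_iff_of_represents {N N' M : ModuleCat.{u} R} {i : ℕ}
    (P : ProjectiveResolution N) (P' : ProjectiveResolution N') (k : N' ⟶ N)
    {f : P.complex.X i ⟶ M} (hf : P.complex.d (i + 1) i ≫ f = 0)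
    {α : ((Ext R (ModuleCat.{u} R) i).obj (Opposite.op N)).obj M} (h : Represents P f α) :
    ((Ext R (ModuleCat.{u} R) i).map k.op).app M α = 0 ↔
      (Ext.mk₀ k).comp (P.extMk f (i + 1) rfl hf) (zero_add i) = 0 := by
  rw [ProjectiveResolution.mk₀_comp_extMk f _ _ hf (liftHom P P' k), extMk_eq_zero_iff_next]
  exact (h.naturality (liftHom P P' k)).eq_zero_iff

theorem subsingleton_localCohomology_iff_pow (a : Ideal R) (M : ModuleCat.{u} R) (i : ℕ) :
    Subsingleton ((localCohomology a i).obj M) ↔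
      ∀ (n : ℕ) (α : ((Ext R (ModuleCat.{u} R) i).obj
        (Opposite.op (ModuleCat.of R (R ⧸ a ^ n)))).obj M),
        ∃ (m : ℕ) (h : n ≤ m), ((Ext R (ModuleCat.{u} R) i).map
          (quotFactor (Ideal.pow_le_pow_right h : a ^ m ≤ a ^ n)).op).app M α = 0 := by
  let D := localCohomology.diagram (localCohomology.idealPowersDiagram a) i
  let D' : ℕᵒᵖᵒᵖ ⥤ ModuleCat.{u} R := D ⋙ (evaluation _ _).obj M
  let c := ((evaluation (ModuleCat.{u} R) (ModuleCat.{u} R)).obj M).mapCocone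
    (Limits.colimit.cocone D)
  have hc : Limits.IsColimit c :=
    Limits.isColimitOfPreserves _ (Limits.colimit.isColimit D)
  have : Limits.PreservesFilteredColimitsOfSize.{0, 0} (forget (ModuleCat.{u} R)) :=
    Limits.preservesFilteredColimitsOfSize_shrink _
  change Subsingleton c.pt ↔ _
  constructor
  · intro hs n α
    have h0 : c.ι.app (Opposite.op (Opposite.op n)) α =
      c.ι.app (Opposite.op (Opposite.op n)) (0 : D'.obj (Opposite.op (Opposite.op n))) :=
      hs.elim _ _
    obtain ⟨k, f, g, hfg⟩ := (Limits.Concrete.isColimit_rep_eq_iff_exists D' hc _ _).1 h0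
    refine ⟨k.unop.unop, f.unop.unop.le, ?_⟩
    refine Eq.trans ?_ (hfg.trans (map_zero _))
    rfl
  · intro h
    refine ⟨fun x y => ?_⟩
    suffices hz : ∀ x : c.pt, x = 0 by rw [hz x, hz y]
    intro x
    obtain ⟨j, z, rfl⟩ := Limits.Concrete.isColimit_exists_rep D' hc x
    obtain ⟨m, hm, hm'⟩ := h j.unop.unop z
    let f : j ⟶ Opposite.op (Opposite.op m) := (homOfLE hm).op.op
    have h1 : D'.map f z = 0 := hm'
    have h2 : c.ι.app _ (D'.map f z) = c.ι.app j z := congrArg (fun g => g z) (c.w f)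
    rw [← h2, h1]
    exact map_zero _

theorem precomp_quotFactor_comp {J J' J'' : Ideal R} (h : J' ≤ J) (h' : J'' ≤ J')
    {M : ModuleCat.{u} R} {i : ℕ} (α : Abelian.Ext (ModuleCat.of R (R ⧸ J)) M i) :
    (Ext.mk₀ (quotFactor h')).comp ((Ext.mk₀ (quotFactor h)).comp α (zero_add i)) (zero_add i) =
      (Ext.mk₀ (quotFactor (h'.trans h))).comp α (zero_add i) := by
  rw [Ext.mk₀_comp_mk₀_assoc]
  congr 2
  ext
  rfl

/-- Since `a` is finitely generated, its powers are cofinal among the ideals whose radical contains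
`a`. -/
theorem subsingleton_localCohomology_iff [IsNoetherianRing R] (a : Ideal R) (M : ModuleCat.{u} R)
    (i : ℕ) : Subsingleton ((localCohomology a i).obj M) ↔ IsEffaceable a M i := by
  rw [subsingleton_localCohomology_iff_pow]
  constructor
  · intro H J hJ α
    obtain ⟨n, hn⟩ := Ideal.exists_pow_le_of_le_radical_of_fg hJ (IsNoetherian.noetherian a)
    let P := projectiveResolution (ModuleCat.of R (R ⧸ a ^ n))
    obtain ⟨f, hf, hfα⟩ := P.extMk_surjective
      ((Ext.mk₀ (quotFactor hn)).comp α (zero_add i)) (i + 1) rfl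
    obtain ⟨β, hβ⟩ := Represents.exists_class P f hf
    obtain ⟨m, hm, hm'⟩ := H n β
    rw [precomp_eq_zero_iff_of_represents P (projectiveResolution _) _ hf hβ, hfα,
      precomp_quotFactor_comp] at hm'
    refine ⟨a ^ (m + 1), (Ideal.pow_le_pow_right (Nat.le_succ m)).trans
      ((Ideal.pow_le_pow_right hm).trans hn), ?_, ?_⟩
    · rw [Ideal.radical_pow _ (Nat.succ_ne_zero m)]
      exact Ideal.le_radical
    · rw [← precomp_quotFactor_comp ((Ideal.pow_le_pow_right hm).trans hn)
        (Ideal.pow_le_pow_right (Nat.le_succ m)), hm', Ext.comp_zero]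
  · intro H n α
    let P := projectiveResolution (ModuleCat.of R (R ⧸ a ^ n))
    obtain ⟨f, hf, hfα⟩ := Represents.exists_rep P α
    have hrad : a ≤ (a ^ n).radical := by
      rcases n with _ | n
      · simp [Ideal.radical_top]
      · rw [Ideal.radical_pow _ (Nat.succ_ne_zero n)]
        exact Ideal.le_radical
    obtain ⟨J', hJ', hr, h0⟩ := H (a ^ n) hrad (P.extMk f (i + 1) rfl hf)
    obtain ⟨m, hm⟩ := Ideal.exists_pow_le_of_le_radical_of_fg hr (IsNoetherian.noetherian a)
    refine ⟨n + m, Nat.le_add_right n m, ?_⟩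
    rw [precomp_eq_zero_iff_of_represents P (projectiveResolution _) _ hf hfα,
      ← precomp_quotFactor_comp hJ' ((Ideal.pow_le_pow_right (Nat.le_add_left m n)).trans hm),
      h0, Ext.comp_zero]

end ExtComparison

/-! ### Upper bounds for cohomological dimension -/

section Effaceable

variable {R : Type u} [CommRing R]

open Abelian

theorem shortExact_of_exact {A B C : Type u} [AddCommGroup A] [AddCommGroup B] [AddCommGroup C]
    [Module R A] [Module R B] [Module R C] {f : A →ₗ[R] B} {g : B →ₗ[R] C}
    (hf : Function.Injective f) (hg : Function.Surjective g) (hfg : Function.Exact f g) :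
    (ModuleCat.shortComplexOfCompEqZero f g hfg.linearMap_comp_eq_zero).ShortExact :=
  ModuleCat.shortComplex_shortExact _ hfg hf hg

theorem IsEffaceable.of_radical_eq {a b : Ideal R} (h : a.radical = b.radical)
    {M : ModuleCat.{u} R} {i : ℕ} (ha : IsEffaceable a M i) : IsEffaceable b M i := by
  have key : ∀ J : Ideal R, a ≤ J.radical ↔ b ≤ J.radical := fun J => by
    rw [← Ideal.radical_le_radical_iff, h, Ideal.radical_le_radical_iff]
  intro J hJ α
  obtain ⟨J', h1, h2, h3⟩ := ha J ((key J).2 hJ) α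
  exact ⟨J', h1, (key J').1 h2, h3⟩

theorem isEffaceable_bot (M : ModuleCat.{u} R) (i : ℕ) : IsEffaceable (⊥ : Ideal R) M (i + 1) := by
  intro J hJ α
  refine ⟨⊥, bot_le, bot_le, ?_⟩
  have : Module.Free R (R ⧸ (⊥ : Ideal R)) :=
    Module.Free.of_equiv (Submodule.quotEquivOfEqBot (⊥ : Ideal R) rfl).symm
  have : Projective (ModuleCat.of R (R ⧸ (⊥ : Ideal R))) := ModuleCat.projective_of_free
    (Module.Free.chooseBasis R _)
  exact Ext.eq_zero_of_projective _

/-- A linear map out of a submodule of the range of `f`, sending `f y` to `g y`. -/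
theorem exists_linearMap_of_ker_le {A B C : Type*} [AddCommGroup A] [AddCommGroup B]
    [AddCommGroup C] [Module R A] [Module R B] [Module R C] (f : A →ₗ[R] B) (g : A →ₗ[R] C)
    (h : LinearMap.ker f ≤ LinearMap.ker g) (B' : Submodule R B) (hB : B' ≤ LinearMap.range f) :
    ∃ w : B' →ₗ[R] C, ∀ (z : B') (y : A), f y = z → w z = g y := by
  refine ⟨((LinearMap.ker f).liftQ g h ∘ₗ f.quotKerEquivRange.symm.toLinearMap) ∘ₗ
    Submodule.inclusion hB, ?_⟩
  intro z y hy
  have : Submodule.inclusion hB z = f.quotKerEquivRange ((LinearMap.ker f).mkQ y) := by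
    ext
    simpa using hy.symm
  simp [this]

theorem exists_torsion_bound [IsNoetherianRing R] (A : Type*) [AddCommGroup A] [Module R A]
    [Module.Finite R A] (x : R) :
    ∃ t : ℕ, ∀ (m : ℕ) (y : A), x ^ m • y = 0 → x ^ t • y = 0 := by
  let F : ℕ →o Submodule R A :=
    { toFun := fun n => LinearMap.ker (LinearMap.lsmul R A (x ^ n))
      monotone' := by
        intro n m hnm y hy
        obtain ⟨k, rfl⟩ := Nat.exists_eq_add_of_le hnm
        have hy' : x ^ n • y = 0 := hy
        change x ^ (n + k) • y = 0
        rw [add_comm, pow_add, mul_smul, hy', smul_zero] }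
  obtain ⟨t, ht⟩ := monotone_stabilizes_iff_noetherian.2 (inferInstance : IsNoetherian R A) F
  refine ⟨t, fun m y hy => ?_⟩
  rcases le_total m t with h | h
  · exact F.monotone h hy
  · have : y ∈ F m := hy
    rw [← ht m h] at this
    exact this

theorem precomp_comp {A B C : ModuleCat.{u} R} (f : A ⟶ B) (g : B ⟶ C) {M : ModuleCat.{u} R}
    {i : ℕ} (α : Ext C M i) :
    (Ext.mk₀ f).comp ((Ext.mk₀ g).comp α (zero_add i)) (zero_add i) =
      (Ext.mk₀ (f ≫ g)).comp α (zero_add i) := by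
  rw [Ext.mk₀_comp_mk₀_assoc]

theorem mapQ_id_surjective {J J' : Ideal R} (h : J' ≤ J) :
    Function.Surjective (Submodule.mapQ J' J LinearMap.id h) := by
  intro y
  obtain ⟨y, rfl⟩ := Submodule.Quotient.mk_surjective _ y
  exact ⟨Submodule.Quotient.mk y, by simp⟩

/-- A class over R/J that dies over R/J₁ comes, by the connecting map, from a class β on the
submodule x^k(R/J₁). Pulled back along multiplication by x^k, β becomes a class on R/J₁ one degree
lower, which dies over some R/J₂. Restriction to x^(k+t)(R/J₂) factors through this pullback once t
bounds the x-power torsion of R/J₂. -/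
theorem IsEffaceable.sup_span [IsNoetherianRing R] {a : Ideal R} {d : ℕ}
    (h : ∀ i, d < i → ∀ M : ModuleCat.{u} R, IsEffaceable a M i) (x : R) (i : ℕ) (hi : d + 1 < i)
    (M : ModuleCat.{u} R) : IsEffaceable (Ideal.span {x} ⊔ a) M i := by
  obtain ⟨j, rfl⟩ : ∃ j, i = j + 1 := ⟨i - 1, by omega⟩
  intro J hJ α
  obtain ⟨k, hk⟩ : x ∈ J.radical :=
    hJ (Submodule.mem_sup_left (Ideal.mem_span_singleton_self x))
  obtain ⟨J₁, hJ₁, hr₁, h₁⟩ := h (j + 1) (by omega) M J (le_sup_right.trans hJ) α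
  let J₁k := J₁ ⊔ Ideal.span {x ^ k}
  have hJ₁k : J₁k ≤ J := sup_le hJ₁ ((Ideal.span_singleton_le_iff_mem J).2 hk)
  have hle₁ : J₁ ≤ J₁k := le_sup_left
  let q := Submodule.mapQ J₁ J₁k LinearMap.id hle₁
  have hS := LinearMap.shortExact_shortComplexKer (mapQ_id_surjective hle₁)
  let α₁ := (Ext.mk₀ (quotFactor hJ₁k)).comp α (zero_add (j + 1))
  have hα₁ : (Ext.mk₀ (quotFactor hle₁)).comp α₁ (zero_add (j + 1)) = 0 := by
    rw [precomp_quotFactor_comp hJ₁k hle₁, h₁]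
  obtain ⟨β, hβ⟩ := Ext.contravariant_sequence_exact₃ hS M α₁ hα₁ (add_comm 1 j)
  have hqk : ∀ y : R ⧸ J₁, q (x ^ k • y) = 0 := by
    intro y
    obtain ⟨y, rfl⟩ := Submodule.Quotient.mk_surjective _ y
    rw [← Submodule.Quotient.mk_smul, Submodule.mapQ_apply, Submodule.Quotient.mk_eq_zero]
    exact Submodule.mem_sup_right (Ideal.mul_mem_right _ _ (Ideal.mem_span_singleton_self _))
  let u : (R ⧸ J₁) →ₗ[R] LinearMap.ker q :=
    LinearMap.codRestrict _ (LinearMap.lsmul R (R ⧸ J₁) (x ^ k)) hqk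
  let γ := (Ext.mk₀ (ModuleCat.ofHom u)).comp β (zero_add j)
  obtain ⟨J₂, hJ₂, hr₂, h₂⟩ := h j (by omega) M J₁ hr₁ γ
  obtain ⟨t, ht⟩ := exists_torsion_bound (R ⧸ J₂) x
  let J₃ := J₂ ⊔ Ideal.span {x ^ (k + t)}
  have hle₂ : J₂ ≤ J₃ := le_sup_left
  have hJ₃ : J₃ ≤ J₁k := by
    refine sup_le (hJ₂.trans hle₁) ((Ideal.span_singleton_le_iff_mem _).2 ?_)
    rw [pow_add]
    exact Submodule.mem_sup_right (Ideal.mul_mem_right _ _ (Ideal.mem_span_singleton_self _))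
  let q' := Submodule.mapQ J₂ J₃ LinearMap.id hle₂
  have hS' := LinearMap.shortExact_shortComplexKer (mapQ_id_surjective hle₂)
  let p := Submodule.mapQ J₂ J₁ LinearMap.id hJ₂
  have hcomm : ∀ y, q (p y) = Submodule.mapQ J₃ J₁k LinearMap.id hJ₃ (q' y) := by
    intro y
    obtain ⟨y, rfl⟩ := Submodule.Quotient.mk_surjective _ y
    simp [q, p, q']
  have hv : ∀ z ∈ LinearMap.ker q', p z ∈ LinearMap.ker q := by
    intro z hz
    rw [LinearMap.mem_ker] at hz ⊢
    rw [hcomm, hz, map_zero]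
  let v : LinearMap.ker q' →ₗ[R] LinearMap.ker q := p.restrict hv
  have hrange : LinearMap.ker q' ≤ LinearMap.range (LinearMap.lsmul R (R ⧸ J₂) (x ^ (k + t))) := by
    intro z hz
    obtain ⟨z, rfl⟩ := Submodule.Quotient.mk_surjective _ z
    rw [LinearMap.mem_ker, Submodule.mapQ_apply, Submodule.Quotient.mk_eq_zero] at hz
    obtain ⟨c, hc, e, he, hce⟩ := Submodule.mem_sup.1 hz
    obtain ⟨r, rfl⟩ := Ideal.mem_span_singleton'.1 he
    refine ⟨Submodule.Quotient.mk r, ?_⟩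
    rw [LinearMap.lsmul_apply, ← Submodule.Quotient.mk_smul, Submodule.Quotient.eq]
    have hce' : c + r * x ^ (k + t) = z := hce
    have : x ^ (k + t) • r - z = -c := by
      rw [← hce', smul_eq_mul]
      ring
    rw [this]
    exact neg_mem hc
  -- The map x^(k+t)y ↦ x^t y is well defined because every element killed by x^(k+t) is already
  -- killed by x^t.
  obtain ⟨w, hw⟩ := exists_linearMap_of_ker_le (LinearMap.lsmul R (R ⧸ J₂) (x ^ (k + t)))
    (LinearMap.lsmul R (R ⧸ J₂) (x ^ t)) (fun y hy => ht _ y hy) _ hrange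
  have hvw : ModuleCat.ofHom v =
      ModuleCat.ofHom w ≫ quotFactor hJ₂ ≫ ModuleCat.ofHom u := by
    ext z
    obtain ⟨y, hy⟩ := hrange z.2
    change p z = x ^ k • p (w z)
    rw [hw z y hy]
    change p z = x ^ k • p (x ^ t • y)
    rw [← map_smul, ← mul_smul, ← pow_add, ← hy]
    rfl
  have hvβ : (Ext.mk₀ (ModuleCat.ofHom v)).comp β (zero_add j) = 0 := by
    rw [hvw, ← precomp_comp, ← precomp_comp, h₂, Ext.comp_zero]
  let φ : q'.shortComplexKer ⟶ q.shortComplexKer :=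
    { τ₁ := ModuleCat.ofHom v
      τ₂ := quotFactor hJ₂
      τ₃ := quotFactor hJ₃
      comm₁₂ := by ext; rfl
      comm₂₃ := ModuleCat.hom_ext (LinearMap.ext hcomm) }
  -- Naturality of the connecting class turns the restriction of α₁ to R/J₃ into the connecting
  -- image of the pullback of β along `v`, which is zero.
  have hnat := ShortComplex.ShortExact.extClass_naturality hS' hS φ
  refine ⟨J₃, hJ₃.trans hJ₁k, ?_, ?_⟩
  · refine sup_le ((Ideal.span_singleton_le_iff_mem _).2 ⟨k + t, ?_⟩)
      (hr₂.trans (Ideal.radical_mono hle₂))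
    exact Submodule.mem_sup_right (Ideal.mem_span_singleton_self _)
  · rw [← precomp_quotFactor_comp hJ₁k hJ₃]
    change (Ext.mk₀ (quotFactor hJ₃)).comp α₁ _ = 0
    rw [← hβ, ← Ext.comp_assoc (Ext.mk₀ (quotFactor hJ₃)) hS.extClass β (zero_add 1)
      (add_comm 1 j) (by lia)]
    have hnat' : (Ext.mk₀ (quotFactor hJ₃)).comp hS.extClass (zero_add 1) =
      hS'.extClass.comp (Ext.mk₀ (ModuleCat.ofHom v)) (add_zero 1) := hnat.symm
    rw [hnat', Ext.comp_assoc hS'.extClass (Ext.mk₀ (ModuleCat.ofHom v)) β (add_zero 1)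
      (zero_add j) (by lia), hvβ, Ext.comp_zero]

theorem isEffaceable_ofList [IsNoetherianRing R] (l : List R) (i : ℕ) (hi : l.length < i)
    (M : ModuleCat.{u} R) : IsEffaceable (Ideal.ofList l) M i := by
  induction l generalizing i M with
  | nil =>
    obtain ⟨j, rfl⟩ : ∃ j, i = j + 1 := ⟨i - 1, by simp at hi; omega⟩
    simpa using isEffaceable_bot M j
  | cons x l ih =>
    rw [Ideal.ofList_cons]
    exact IsEffaceable.sup_span (d := l.length) (fun i hi M => ih i hi M) x i
      (by simpa using hi) M

theorem IsEffaceable.of_exact {a : Ideal R} {i : ℕ} {S : ShortComplex (ModuleCat.{u} R)}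
    (hS : S.ShortExact) (h₁ : IsEffaceable a S.X₁ i) (h₃ : IsEffaceable a S.X₃ i) :
    IsEffaceable a S.X₂ i := by
  intro J hJ α
  obtain ⟨J', hJ', hr', h'⟩ := h₃ J hJ (α.comp (Ext.mk₀ S.g) (add_zero i))
  rw [← Ext.comp_assoc _ _ _ (zero_add i) (add_zero i) (by lia)] at h'
  obtain ⟨β, hβ⟩ := Ext.covariant_sequence_exact₂ _ hS _ h'
  obtain ⟨J'', hJ'', hr'', h''⟩ := h₁ J' hr' β
  refine ⟨J'', hJ''.trans hJ', hr'', ?_⟩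
  rw [← precomp_quotFactor_comp hJ' hJ'', ← hβ,
    ← Ext.comp_assoc _ _ _ (zero_add i) (add_zero i) (by lia), h'', Ext.zero_comp]

theorem IsEffaceable.of_exact_right {a : Ideal R} {i : ℕ} {S : ShortComplex (ModuleCat.{u} R)}
    (hS : S.ShortExact) (h₁ : IsEffaceable a S.X₁ (i + 1)) (h₂ : IsEffaceable a S.X₂ i) :
    IsEffaceable a S.X₃ i := by
  intro J hJ α
  obtain ⟨J', hJ', hr', h'⟩ := h₁ J hJ (α.comp hS.extClass rfl)
  rw [← Ext.comp_assoc _ _ _ (zero_add i) rfl (by lia)] at h'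
  obtain ⟨β, hβ⟩ := Ext.covariant_sequence_exact₃ _ hS _ rfl h'
  obtain ⟨J'', hJ'', hr'', h''⟩ := h₂ J' hr' β
  refine ⟨J'', hJ''.trans hJ', hr'', ?_⟩
  rw [← precomp_quotFactor_comp hJ' hJ'', ← hβ,
    ← Ext.comp_assoc _ _ _ (zero_add i) (add_zero i) (by lia), h'', Ext.zero_comp]

theorem isEffaceable_of_subsingleton (a : Ideal R) (i : ℕ) (M : Type u) [AddCommGroup M]
    [Module R M] [Subsingleton M] : IsEffaceable a (ModuleCat.of R M) i := by
  intro J hJ α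
  refine ⟨J, le_rfl, hJ, ?_⟩
  have h0 : 𝟙 (ModuleCat.of R M) = 0 := by
    ext y
    exact Subsingleton.elim _ _
  have hα : α = 0 := by
    rw [← Ext.comp_mk₀_id α, h0, Ext.mk₀_zero, Ext.comp_zero]
  rw [hα, Ext.comp_zero]

/-- Descending induction on `i`, starting above the number of generators of `a`. A prime filtration
reduces to N ≅ R/p = R/K, where H^i(N) lies between H^i(R) = 0 and H^(i+1)(K), zero by induction. -/
theorem isEffaceable_finite_of_ring [IsNoetherianRing R] {a : Ideal R} {c : ℕ}
    (h : ∀ i, c < i → IsEffaceable a (ModuleCat.of R R) i) (i : ℕ) (hi : c < i)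
    (M : Type u) [AddCommGroup M] [Module R M] [Module.Finite R M] :
    IsEffaceable a (ModuleCat.of R M) i := by
  obtain ⟨l, rfl⟩ : ∃ l : List R, Ideal.ofList l = a := by
    obtain ⟨s, hs⟩ := IsNoetherian.noetherian a
    exact ⟨s.toList, by simpa [Ideal.ofList] using hs⟩
  -- Here `n` exceeds the distance by which `i` lies below the number of generators; `n = 0` is the
  -- range where all modules have vanishing cohomology.
  suffices H : ∀ n i, c < i → l.length < i + n → ∀ (M : Type u) [AddCommGroup M] [Module R M]
      [Module.Finite R M], IsEffaceable (Ideal.ofList l) (ModuleCat.of R M) i from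
    H (l.length + 1) i hi (by omega) M
  intro n
  induction n with
  | zero => exact fun i _ hi M _ _ _ => isEffaceable_ofList l i (by simpa using hi) _
  | succ n ih =>
    intro i hc hi M _ _ hM
    induction hM using IsNoetherianRing.induction_on_isQuotientEquivQuotientPrime R with
    | subsingleton N => exact isEffaceable_of_subsingleton _ _ N
    | quotient N p e =>
      let g : R →ₗ[R] N := e.symm.toLinearMap ∘ₗ p.1.mkQ
      have hg : Function.Surjective g := e.symm.surjective.comp (Submodule.mkQ_surjective _)
      exact IsEffaceable.of_exact_right (LinearMap.shortExact_shortComplexKer hg)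
        (ih (i + 1) (by omega) (by omega) (LinearMap.ker g)) (h i hc)
    | exact N₁ N₂ N₃ f g hf hg hfg h₁ h₃ =>
      exact IsEffaceable.of_exact (shortExact_of_exact hf hg hfg) h₁ h₃

end Effaceable

/-! ### Grade through Ext, and its comparison with cohomological dimension -/

section Grade

variable {R : Type u} [CommRing R]

open Abelian RingTheory.Sequence Pointwise

theorem subsingleton_of_forall_eq_zero {A : Type*} [AddCommGroup A] (h : ∀ x : A, x = 0) :
    Subsingleton A :=
  ⟨fun x y => (h x).trans (h y).symm⟩

section LongExactSequences

variable {S : ShortComplex (ModuleCat.{u} R)} (hS : S.ShortExact) (X : ModuleCat.{u} R) (i : ℕ)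

include hS

theorem subsingleton_ext_X₃ (h₂ : Subsingleton (Ext X S.X₂ i))
    (h₁ : Subsingleton (Ext X S.X₁ (i + 1))) : Subsingleton (Ext X S.X₃ i) := by
  refine subsingleton_of_forall_eq_zero fun x => ?_
  obtain ⟨w, rfl⟩ := Ext.covariant_sequence_exact₃ _ hS x rfl (h₁.elim _ _)
  rw [h₂.elim w 0, Ext.zero_comp]

theorem subsingleton_ext_left_X₁ (h₂ : Subsingleton (Ext S.X₂ X i))
    (h₃ : Subsingleton (Ext S.X₃ X (i + 1))) : Subsingleton (Ext S.X₁ X i) := by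
  refine subsingleton_of_forall_eq_zero fun x => ?_
  obtain ⟨w, rfl⟩ := Ext.contravariant_sequence_exact₁ hS _ x (add_comm 1 i) (h₃.elim _ _)
  rw [h₂.elim w 0, Ext.comp_zero]

theorem subsingleton_ext_left_X₃ (h₁ : Subsingleton (Ext S.X₁ X i))
    (h₂ : Subsingleton (Ext S.X₂ X (i + 1))) : Subsingleton (Ext S.X₃ X (i + 1)) := by
  refine subsingleton_of_forall_eq_zero fun x => ?_
  obtain ⟨w, rfl⟩ := Ext.contravariant_sequence_exact₃ hS _ x (h₂.elim _ _) (add_comm 1 i)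
  rw [h₁.elim w 0, Ext.comp_zero]

end LongExactSequences

theorem support_quotient_eq_zeroLocus (a : Ideal R) :
    Module.support R (R ⧸ a) = PrimeSpectrum.zeroLocus a := by
  rw [Module.support_eq_zeroLocus, Ideal.annihilator_quotient]

theorem smul_top_quotSMulTop_ne_top {M : Type*} [AddCommGroup M] [Module R M] {a : Ideal R} {x : R}
    (hx : x ∈ a) (ha : a • (⊤ : Submodule R M) ≠ ⊤) :
    a • (⊤ : Submodule R (QuotSMulTop x M)) ≠ ⊤ := by
  intro h
  apply ha
  have h2 := congrArg (Submodule.comap (Submodule.mkQ (x • (⊤ : Submodule R M)))) h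
  have hle : x • (⊤ : Submodule R M) ≤ a • ⊤ := by
    rw [← Submodule.ideal_span_singleton_smul]
    exact Submodule.smul_mono_left ((Ideal.span_singleton_le_iff_mem a).mpr hx)
  simpa [Submodule.comap_smul_top_of_surjective a _ (Submodule.mkQ_surjective _), hle] using h2

/-- If all Ext vanished, `a` would contain an M-regular `x`, and all Ext into M/xM would vanish too.
Presenting M as a quotient of a fixed M₀ makes this a Noetherian induction on the kernel, which
grows strictly. -/
theorem exists_nontrivial_ext_of_surjective [IsNoetherianRing R] (a : Ideal R) (M₀ : Type u)
    [AddCommGroup M₀] [Module R M₀] [Module.Finite R M₀] (N : Submodule R M₀) :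
    ∀ (M : Type u) [AddCommGroup M] [Module R M] (f : M₀ →ₗ[R] M), Function.Surjective f →
      LinearMap.ker f = N → a • (⊤ : Submodule R M) ≠ ⊤ →
      ∃ i, Nontrivial (Ext (ModuleCat.of R (R ⧸ a)) (ModuleCat.of R M) i) := by
  induction N using WellFoundedGT.induction with
  | ind N ih =>
    intro M _ _ f hf hN ha
    by_contra! hcon
    have : Module.Finite R M := Module.Finite.of_surjective f hf
    obtain ⟨rs, hlen, hmem, hreg⟩ := ModuleCat.exists_isRegular_of_exists_subsingleton_ext a 1
      (ModuleCat.of R M) ha.lt_top (ModuleCat.of R (R ⧸ a)) (support_quotient_eq_zeroLocus a)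
      (fun i _ => hcon i)
    obtain ⟨x, rfl⟩ := List.length_eq_one_iff.1 hlen
    have hxa : x ∈ a := hmem x (by simp)
    have hx : IsSMulRegular M x := ((isRegular_cons_iff _ _ _).1 hreg).1
    have hS := IsSMulRegular.smulShortComplex_shortExact (M := ModuleCat.of R M) hx
    -- Equality would mean xM = 0, and regularity of `x` would then force M = 0.
    have hlt : N < LinearMap.ker ((x • (⊤ : Submodule R M)).mkQ ∘ₗ f) := by
      refine lt_of_le_of_ne (hN ▸ LinearMap.ker_le_ker_comp _ _) fun heq => ha ?_
      have hz : ∀ y : M, x • y = 0 := by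
        intro y
        obtain ⟨z, hz⟩ := hf (x • y)
        have hmem : z ∈ LinearMap.ker ((x • (⊤ : Submodule R M)).mkQ ∘ₗ f) := by
          simp only [LinearMap.mem_ker, LinearMap.comp_apply, hz, Submodule.mkQ_apply,
            Submodule.Quotient.mk_eq_zero]
          exact Submodule.smul_mem_pointwise_smul _ _ _ trivial
        rw [← heq, ← hN, LinearMap.mem_ker, hz] at hmem
        exact hmem
      have hsub : Subsingleton M := ⟨fun y z => hx (by simp [hz])⟩
      exact Subsingleton.elim _ _
    obtain ⟨i, hi⟩ := ih _ hlt (QuotSMulTop x M) ((x • (⊤ : Submodule R M)).mkQ ∘ₗ f)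
      ((Submodule.mkQ_surjective _).comp hf) rfl (smul_top_quotSMulTop_ne_top hxa ha)
    exact not_subsingleton_iff_nontrivial.2 hi
      (subsingleton_ext_X₃ hS _ i (hcon i) (hcon (i + 1)))

theorem exists_nontrivial_ext [IsNoetherianRing R] (a : Ideal R) (M : Type u)
    [AddCommGroup M] [Module R M] [Module.Finite R M] (ha : a • (⊤ : Submodule R M) ≠ ⊤) :
    ∃ i, Nontrivial (Ext (ModuleCat.of R (R ⧸ a)) (ModuleCat.of R M) i) :=
  exists_nontrivial_ext_of_surjective a M _ M LinearMap.id Function.surjective_id rfl ha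

theorem exists_grade_eq [IsNoetherianRing R] (a : Ideal R) (M : Type u)
    [AddCommGroup M] [Module R M] [Module.Finite R M] (ha : a • (⊤ : Submodule R M) ≠ ⊤) :
    ∃ g : ℕ, grade a M = g ∧ Nontrivial (Ext (ModuleCat.of R (R ⧸ a)) (ModuleCat.of R M) g) ∧
      ∃ rs : List R, rs.length = g ∧ (∀ x ∈ rs, x ∈ a) ∧ IsRegular M rs := by
  classical
  have hex := exists_nontrivial_ext a M ha
  let g := Nat.find hex
  have hg := Nat.find_spec hex
  obtain ⟨rs, hlen, hmem, hreg⟩ := ModuleCat.exists_isRegular_of_exists_subsingleton_ext a g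
    (ModuleCat.of R M) ha.lt_top (ModuleCat.of R (R ⧸ a)) (support_quotient_eq_zeroLocus a)
    (fun i hi => not_nontrivial_iff_subsingleton.1 (Nat.find_min hex hi))
  refine ⟨g, ?_, hg, rs, hlen, hmem, hreg⟩
  rw [grade, if_neg ha]
  apply le_antisymm
  · apply sSup_le
    rintro _ ⟨rs', hreg', hmem', rfl⟩
    by_contra! hlt
    have hlt' : g < rs'.length := by exact_mod_cast hlt
    exact not_subsingleton_iff_nontrivial.2 hg
      (ModuleCat.subsingleton_ext_of_exists_isRegular a (ModuleCat.of R (R ⧸ a))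
        (support_quotient_eq_zeroLocus a).subset (ModuleCat.of R M) ha.lt_top rs' hmem' hreg' g hlt')
  · exact le_sSup ⟨rs, hreg, hmem, by rw [hlen]⟩

/-- The kernel a/J of R/J → R/a is supported on V(a), so its Ext into M vanishes below the length of
`rs`. Hence restriction from R/a to R/J is injective on Ext in degree `rs.length`, and no nonzero
class can die. -/
theorem not_isEffaceable_of_isRegular [IsNoetherianRing R] {a : Ideal R} {M : Type u}
    [AddCommGroup M] [Module R M] [Module.Finite R M] (ha : a • (⊤ : Submodule R M) ≠ ⊤)
    {rs : List R} (hmem : ∀ x ∈ rs, x ∈ a) (hreg : IsRegular M rs)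
    (hnt : Nontrivial (Ext (ModuleCat.of R (R ⧸ a)) (ModuleCat.of R M) rs.length)) :
    ¬ IsEffaceable a (ModuleCat.of R M) rs.length := by
  intro h
  obtain ⟨α, hα⟩ := exists_ne (0 : Ext (ModuleCat.of R (R ⧸ a)) (ModuleCat.of R M) rs.length)
  obtain ⟨J, hJ, hr, h0⟩ := h a Ideal.le_radical α
  apply hα
  have hS := LinearMap.shortExact_shortComplexKer (mapQ_id_surjective hJ)
  have key : ∀ i < rs.length, Subsingleton (Ext (ModuleCat.of R
      (LinearMap.ker (Submodule.mapQ J a LinearMap.id hJ))) (ModuleCat.of R M) i) := by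
    refine ModuleCat.subsingleton_ext_of_exists_isRegular a _ ?_ (ModuleCat.of R M) ha.lt_top rs
      hmem hreg
    rw [Module.support_eq_zeroLocus, PrimeSpectrum.zeroLocus_subset_zeroLocus_iff]
    refine hr.trans (Ideal.radical_mono ?_)
    intro r hr
    rw [Module.mem_annihilator]
    intro y
    apply Subtype.ext
    obtain ⟨z, hz⟩ := Submodule.Quotient.mk_surjective _ y.1
    change r • y.1 = 0
    rw [← hz, ← Submodule.Quotient.mk_smul, Submodule.Quotient.mk_eq_zero]
    exact Ideal.mul_mem_right _ _ hr
  generalize rs.length = n at *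
  rcases n with _ | n
  · have : Epi (quotFactor hJ) := hS.epi_g
    exact Ext.precomp_mk₀_injective_of_epi (ModuleCat.of R M) (quotFactor hJ)
      (h0.trans (map_zero _).symm)
  · obtain ⟨β, hβ⟩ := Ext.contravariant_sequence_exact₃ hS _ α h0 (add_comm 1 n)
    rw [← hβ, (key n (Nat.lt_succ_self n)).elim β 0, Ext.comp_zero]

theorem cd_le_of_isEffaceable [IsNoetherianRing R] {a : Ideal R} {M : Type u} [AddCommGroup M]
    [Module R M] {n : ℕ} (h : ∀ i, n < i → IsEffaceable a (ModuleCat.of R M) i) :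
    cd a M ≤ (n : WithBot ℕ∞) := by
  apply sSup_le
  rintro _ ⟨i, hi, rfl⟩
  by_contra! hlt
  have : n < i := by exact_mod_cast hlt
  exact not_subsingleton_iff_nontrivial.2 hi ((subsingleton_localCohomology_iff a _ i).2 (h i this))

theorem le_cd_of_not_isEffaceable [IsNoetherianRing R] {a : Ideal R} {M : Type u} [AddCommGroup M]
    [Module R M] {n : ℕ} (h : ¬ IsEffaceable a (ModuleCat.of R M) n) :
    (n : WithBot ℕ∞) ≤ cd a M := by
  apply le_sSup
  refine ⟨n, ?_, rfl⟩
  rwa [← not_subsingleton_iff_nontrivial, subsingleton_localCohomology_iff]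

theorem grade_le_cd [IsNoetherianRing R] (a : Ideal R) (M : Type u)
    [AddCommGroup M] [Module R M] [Module.Finite R M] (ha : a • (⊤ : Submodule R M) ≠ ⊤) :
    (grade a M : WithBot ℕ∞) ≤ cd a M := by
  obtain ⟨g, hg, hnt, rs, rfl, hmem, hreg⟩ := exists_grade_eq a M ha
  rw [hg]
  exact le_cd_of_not_isEffaceable (not_isEffaceable_of_isRegular ha hmem hreg hnt)

theorem cd_le_of_isEffaceable_ring [IsNoetherianRing R] (a : Ideal R) (M : Type u) [AddCommGroup M]
    [Module R M] [Module.Finite R M] {n : ℕ} (h : cd a R ≤ (n : WithBot ℕ∞)) :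
    cd a M ≤ (n : WithBot ℕ∞) := by
  apply cd_le_of_isEffaceable
  intro i hi
  refine isEffaceable_finite_of_ring (c := n) ?_ i hi M
  intro i hi
  by_contra hcon
  have := (le_cd_of_not_isEffaceable hcon).trans h
  have : i ≤ n := by exact_mod_cast this
  omega

theorem IsRelMaximalCohenMacaulay.isRelCohenMacaulay [IsNoetherianRing R] {a : Ideal R} {M : Type u}
    [AddCommGroup M] [Module R M] [Module.Finite R M] (h : IsRelMaximalCohenMacaulay a M) :
    IsRelCohenMacaulay a M := by
  by_cases ha : a • (⊤ : Submodule R M) = ⊤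
  · exact Or.inl ha
  refine Or.inr ⟨ha, le_antisymm (grade_le_cd a M ha) ?_⟩
  obtain ⟨g, hg, -⟩ := exists_grade_eq a M ha
  rw [IsRelMaximalCohenMacaulay, hg] at h
  rw [hg]
  exact cd_le_of_isEffaceable_ring a M h.symm.le

theorem IsRelGorenstein.isRelMaximalCohenMacaulay [IsNoetherianRing R] {a : Ideal R} {M : Type u}
    [AddCommGroup M] [Module R M] [Module.Finite R M] (ha : a • (⊤ : Submodule R M) ≠ ⊤)
    (h : IsRelGorenstein a M) : IsRelMaximalCohenMacaulay a M := by
  obtain ⟨g, hg, hnt, -⟩ := exists_grade_eq a M ha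
  rw [IsRelMaximalCohenMacaulay, hg]
  by_contra hne
  exact not_subsingleton_iff_nontrivial.2 hnt (h g hne)

theorem cd_le_length [IsNoetherianRing R] {a : Ideal R} {l : List R}
    (h : (Ideal.ofList l).radical = a.radical) (M : Type u) [AddCommGroup M] [Module R M] :
    cd a M ≤ (l.length : WithBot ℕ∞) :=
  cd_le_of_isEffaceable fun i hi => (isEffaceable_ofList l i hi _).of_radical_eq h

/-- An ideal generated by a regular sequence has cohomological dimension equal to its length. -/
theorem cd_ofList_of_isRegular [IsNoetherianRing R] {rs : List R} (h : IsRegular R rs) :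
    cd (Ideal.ofList rs) R = (rs.length : WithBot ℕ∞) := by
  refine le_antisymm (cd_le_length rfl R) ?_
  have ha : Ideal.ofList rs • (⊤ : Submodule R R) ≠ ⊤ := h.2.symm
  refine le_trans ?_ (grade_le_cd _ R ha)
  rw [grade, if_neg ha]
  have : (rs.length : ℕ∞) ≤ sSup {n : ℕ∞ | ∃ rs' : List R, IsRegular R rs' ∧
      (∀ x ∈ rs', x ∈ Ideal.ofList rs) ∧ n = (rs'.length : ℕ∞)} :=
    le_sSup ⟨rs, h, fun x hx => Ideal.subset_span hx, rfl⟩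
  exact_mod_cast this

end Grade

/-! ### The completion is Noetherian; regular implies complete intersection -/

section Completion

variable {R : Type u} [CommRing R]

open RingTheory.Sequence

section PowerSeries

variable {n : ℕ} (a : Ideal R) (g : Fin n → R) (hg : ∀ i, g i ∈ a)

include hg in
theorem idealOfVars_pow_le_comap (k : ℕ) :
    MvPolynomial.idealOfVars (Fin n) R ^ k ≤
      (a ^ k).comap (MvPolynomial.aeval (R := R) g : MvPolynomial (Fin n) R →ₐ[R] R).toRingHom := by
  refine le_trans (Ideal.pow_right_mono ?_ k) (Ideal.le_comap_pow _ k)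
  rw [MvPolynomial.idealOfVars, Ideal.span_le]
  rintro _ ⟨i, rfl⟩
  simpa using hg i

/-- Evaluation of power series modulo a power of an ideal. -/
def powerSeriesEvalMod (k : ℕ) : MvPowerSeries (Fin n) R →+* R ⧸ a ^ k :=
  (Ideal.quotientMap (a ^ k)
    (MvPolynomial.aeval (R := R) g : MvPolynomial (Fin n) R →ₐ[R] R).toRingHom
    (idealOfVars_pow_le_comap a g hg k)).comp
    (MvPowerSeries.truncTotalAlgHom (Fin n) R k).toRingHom

theorem factorPow_comp_powerSeriesEvalMod {m k : ℕ} (hkm : m ≤ k) :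
    (Ideal.Quotient.factorPow a hkm).comp (powerSeriesEvalMod a g hg k) =
      powerSeriesEvalMod a g hg m := by
  ext p
  have h := idealOfVars_pow_le_comap a g hg m
    (MvPowerSeries.truncTotal_sub_truncTotal_mem_pow_idealOfVars hkm le_rfl p)
  rw [Ideal.mem_comap, map_sub] at h
  exact (Ideal.Quotient.mk_eq_mk_iff_sub_mem _ _).2 h

/-- Evaluation of power series at elements of `a`, with values in the completion. -/
def powerSeriesEval : MvPowerSeries (Fin n) R →+* AdicCompletion a R :=
  AdicCompletion.liftRingHom a (powerSeriesEvalMod a g hg)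
    (factorPow_comp_powerSeriesEvalMod a g hg)

theorem powerSeriesEval_coe (p : MvPolynomial (Fin n) R) :
    powerSeriesEval a g hg (p : MvPowerSeries (Fin n) R) =
      algebraMap R (AdicCompletion a R) (MvPolynomial.aeval g p) := by
  apply AdicCompletion.ext_evalₐ
  intro k
  rw [powerSeriesEval, AdicCompletion.evalₐ_liftRingHom _ _
    (factorPow_comp_powerSeriesEvalMod a g hg), AlgHom.commutes]
  have h := (MvPowerSeries.truncTotalAlgHom (Fin n) R k).commutes p
  have h' : MvPowerSeries.truncTotalAlgHom (Fin n) R k (p : MvPowerSeries (Fin n) R) =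
    Ideal.Quotient.mk _ p := h
  change Ideal.quotientMap (a ^ k) _ (idealOfVars_pow_le_comap a g hg k)
    (MvPowerSeries.truncTotalAlgHom (Fin n) R k _) = _
  rw [h', Ideal.quotientMap_mk]
  rfl

/-- The variables generate the extension of `a`, so surjectivity may be tested modulo them; there
constants suffice, as the completion modulo this extension is R/a. -/
theorem powerSeriesEval_surjective [IsNoetherianRing R] (hspan : Ideal.span (Set.range g) = a) :
    Function.Surjective (powerSeriesEval a g hg) := by
  have hmap : (Ideal.span (Set.range MvPowerSeries.X)).map (powerSeriesEval a g hg) =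
      a.map (algebraMap R (AdicCompletion a R)) := by
    rw [Ideal.map_span, ← Set.range_comp]
    have h : (Ideal.span (Set.range g)).map (algebraMap R (AdicCompletion a R)) =
        a.map (algebraMap R (AdicCompletion a R)) := congrArg _ hspan
    rw [← h, Ideal.map_span, ← Set.range_comp]
    congr 2
    funext i
    have := powerSeriesEval_coe a g hg (MvPolynomial.X i)
    simpa using this
  have hfg : a.FG := IsNoetherian.noetherian a
  have hcomp : IsAdicComplete a (AdicCompletion a R) := AdicCompletion.isAdicComplete hfg
  have : IsHausdorff ((Ideal.span (Set.range MvPowerSeries.X)).map (powerSeriesEval a g hg))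
      (AdicCompletion a R) := by
    rw [hmap, IsHausdorff.map_algebraMap_iff]
    exact hcomp.toIsHausdorff
  apply surjective_of_mk_map_comp_surjective (I := Ideal.span (Set.range MvPowerSeries.X))
  intro y
  obtain ⟨y, rfl⟩ := Ideal.Quotient.mk_surjective y
  obtain ⟨r, hr⟩ := Ideal.Quotient.mk_surjective (AdicCompletion.evalOneₐ a y)
  refine ⟨((MvPolynomial.C r : MvPolynomial (Fin n) R) : MvPowerSeries (Fin n) R), ?_⟩
  rw [RingHom.comp_apply, powerSeriesEval_coe, Ideal.Quotient.eq, hmap,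
    ← AdicCompletion.ker_evalOneₐ_eq_map a hfg, RingHom.mem_ker]
  have : AdicCompletion.evalOneₐ a (algebraMap R (AdicCompletion a R) r - y) = 0 := by
    rw [map_sub, AlgHom.commutes, ← hr, sub_eq_zero]
    rfl
  simpa using this

end PowerSeries

instance isNoetherianRing_adicCompletion [IsNoetherianRing R] (a : Ideal R) :
    IsNoetherianRing (AdicCompletion a R) := by
  obtain ⟨n, g, hg⟩ := Submodule.fg_iff_exists_fin_generating_family.1 (IsNoetherian.noetherian a)
  have hmem : ∀ i, g i ∈ a := fun i => hg ▸ Submodule.subset_span ⟨i, rfl⟩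
  exact isNoetherianRing_of_surjective _ _ (powerSeriesEval a g hmem)
    (powerSeriesEval_surjective a g hmem hg)

theorem map_adicCompletion_ne_top [IsNoetherianRing R] {a : Ideal R} (ha : a ≠ ⊤) :
    a.map (algebraMap R (AdicCompletion a R)) ≠ ⊤ := by
  rw [← AdicCompletion.ker_evalOneₐ_eq_map a (IsNoetherian.noetherian a)]
  have : Nontrivial (R ⧸ a) := Ideal.Quotient.nontrivial_iff.2 ha
  exact RingHom.ker_ne_top _

theorem IsRelRegular.isRelCompleteIntersection [IsNoetherianRing R] {a : Ideal R} (ha : a ≠ ⊤)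
    (h : IsRelRegular a R) : IsRelCompleteIntersection R a := by
  rcases h with h | ⟨-, rs, hrs, hlen, hreg, -⟩
  · exact absurd (by simpa using h) ha
  let T := AdicCompletion a R
  let φ := algebraMap R T
  have hb : Ideal.ofList (rs.map φ) = a.map φ := by rw [← Ideal.map_ofList, hrs]
  have htop : a.map φ • (⊤ : Submodule T T) ≠ ⊤ := by
    simpa using map_adicCompletion_ne_top ha
  have hreg' : IsRegular T (rs.map φ) := by
    refine ⟨hreg.1.of_flat, ?_⟩
    rw [hb]
    exact htop.symm
  have hcd : ((rs.map φ).length : WithBot ℕ∞) = cd (a.map φ) T := by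
    rw [← hb, cd_ofList_of_isRegular hreg']
  have hbot : Ideal.ofList ([] : List T) = ⊥ := Ideal.ofList_nil
  have : Nontrivial T := by
    by_contra hcon
    rw [not_nontrivial_iff_subsingleton] at hcon
    exact map_adicCompletion_ne_top ha (Subsingleton.elim _ _)
  refine ⟨T, inferInstance, inferInstance, a.map φ, [],
    (Ideal.quotEquivOfEq hbot).trans (RingEquiv.quotientBot T), map_adicCompletion_ne_top ha,
    by simp, ⟨rs.map φ, htop, ?_, hcd, ?_⟩, ?_, Or.inr ⟨htop, rs.map φ, hb, hcd, hreg', hreg'⟩, ?_⟩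
  · intro x hx
    rw [← hb]
    exact Ideal.subset_span hx
  · rw [List.nil_append, hb]
  · exact IsRegular.nil T T
  · rw [show ((((Ideal.quotEquivOfEq hbot).trans (RingEquiv.quotientBot T) :
      (T ⧸ Ideal.ofList ([] : List T)) ≃+* T) : (T ⧸ Ideal.ofList ([] : List T)) →+* T).comp
        (Ideal.Quotient.mk (Ideal.ofList []))) = RingHom.id T from RingHom.ext fun x => rfl,
      Ideal.map_id]

end Completion

/-! ### Rees's change of rings modulo one regular element -/

section ChangeOfRings

open Abelian RingTheory.Sequence Pointwise

theorem subsingleton_ext_left_of_iso {R : Type u} [CommRing R] {N N' : ModuleCat.{u} R}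
    (e : N ≅ N') (M : ModuleCat.{u} R) (i : ℕ) (h : Subsingleton (Ext N M i)) :
    Subsingleton (Ext N' M i) := by
  refine subsingleton_of_forall_eq_zero fun α => ?_
  rw [← Ext.mk₀_id_comp α, ← e.inv_hom_id, ← precomp_comp,
    h.elim ((Ext.mk₀ e.hom).comp α (zero_add i)) 0, Ext.comp_zero]

theorem subsingleton_ext_right_of_iso {R : Type u} [CommRing R] {M M' : ModuleCat.{u} R}
    (e : M ≅ M') (N : ModuleCat.{u} R) (i : ℕ) (h : Subsingleton (Ext N M i)) :
    Subsingleton (Ext N M' i) := by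
  refine subsingleton_of_forall_eq_zero fun α => ?_
  rw [← Ext.comp_mk₀_id α, ← e.inv_hom_id, ← Ext.mk₀_comp_mk₀,
    ← Ext.comp_assoc _ _ _ (add_zero i) (zero_add 0) (by lia),
    h.elim (α.comp (Ext.mk₀ e.inv) (add_zero i)) 0, Ext.zero_comp]

/-- By the long exact sequence of multiplication by a regular element, each quotient raises the
vanishing bound by one. -/
theorem subsingleton_ext_quotient_isWeaklyRegular {T : Type u} [CommRing T] (M : ModuleCat.{u} T)
    (rs : List T) : ∀ (d : ℕ) (N : Type u) [AddCommGroup N] [Module T N],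
      IsWeaklyRegular N rs → (∀ j, d < j → Subsingleton (Ext (ModuleCat.of T N) M j)) →
      ∀ j, d + rs.length < j →
        Subsingleton (Ext (ModuleCat.of T (N ⧸ (Ideal.ofList rs • ⊤ : Submodule T N))) M j) := by
  induction rs with
  | nil =>
    intro d N _ _ _ h j hj
    have e : (N ⧸ (Ideal.ofList ([] : List T) • ⊤ : Submodule T N)) ≃ₗ[T] N :=
      Submodule.quotEquivOfEqBot _ (by rw [Ideal.ofList_nil, Submodule.bot_smul])
    exact subsingleton_ext_left_of_iso e.symm.toModuleIso M j (h j (by simpa using hj))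
  | cons x rs ih =>
    intro d N _ _ hreg h j hj
    rw [isWeaklyRegular_cons_iff] at hreg
    refine subsingleton_ext_left_of_iso
      (Submodule.quotOfListConsSMulTopEquivQuotSMulTopInner N x rs).symm.toModuleIso M j
      (ih (d + 1) (QuotSMulTop x N) hreg.2 ?_ j (by simp at hj; omega))
    intro k hk
    obtain ⟨k, rfl⟩ : ∃ l, k = l + 1 := ⟨k - 1, by omega⟩
    have hS := IsSMulRegular.smulShortComplex_shortExact (M := ModuleCat.of T N) hreg.1
    exact subsingleton_ext_left_X₃ hS M k (h k (by omega)) (h (k + 1) (by omega))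

theorem subsingleton_ext_quotient_ofList {T : Type u} [CommRing T] [IsNoetherianRing T]
    {rs : List T} (hreg : IsRegular T rs) {j : ℕ} (hj : j ≠ rs.length) :
    Subsingleton (Ext (ModuleCat.of T (T ⧸ Ideal.ofList rs)) (ModuleCat.of T T) j) := by
  have htop : Ideal.ofList rs • (⊤ : Submodule T T) ≠ ⊤ := hreg.2.symm
  rcases lt_or_gt_of_ne hj with hj | hj
  · exact ModuleCat.subsingleton_ext_of_exists_isRegular (Ideal.ofList rs) _
      (support_quotient_eq_zeroLocus _).subset (ModuleCat.of T T) htop.lt_top rs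
      (fun x hx => Ideal.subset_span hx) hreg j hj
  · have e : (T ⧸ (Ideal.ofList rs • ⊤ : Submodule T T)) ≃ₗ[T] (T ⧸ Ideal.ofList rs) :=
      Submodule.quotEquivOfEq _ _ (by simp)
    refine subsingleton_ext_left_of_iso e.toModuleIso _ j
      (subsingleton_ext_quotient_isWeaklyRegular _ rs 0 T hreg.1 ?_ j (by simpa using hj))
    intro k hk
    obtain ⟨k, rfl⟩ : ∃ l, k = l + 1 := ⟨k - 1, by omega⟩
    have : Projective (ModuleCat.of T T) :=
      ModuleCat.projective_of_free (Module.Basis.singleton Unit T)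
    exact Ext.subsingleton_of_projective _ _ _

variable {T S : Type u} [CommRing T] [CommRing S] (f : T →+* S)

/-- The sequence `A → A → B` given by multiplication by `x` and a semilinear map with kernel
`xA`, as a sequence of `T`-modules. -/
abbrev smulSequence {A B : Type u} [AddCommGroup A] [Module T A] [AddCommGroup B] [Module S B]
    (x : T) (g : A →ₛₗ[f] B) (hg : ∀ y, g y = 0 ↔ ∃ z, x • z = y) :
    ShortComplex (ModuleCat.{u} T) where
  X₁ := ModuleCat.of T A
  X₂ := ModuleCat.of T A
  X₃ := (ModuleCat.restrictScalars f).obj (ModuleCat.of S B)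
  f := x • 𝟙 _
  g := ModuleCat.ofHom (Y := (ModuleCat.restrictScalars f).obj (ModuleCat.of S B))
    { toFun := fun y => g y
      map_add' := fun y z => g.map_add y z
      map_smul' := fun t y => g.map_smulₛₗ t y }
  zero := by
    ext y
    exact (hg (x • y)).2 ⟨y, rfl⟩

variable {f} in
theorem smulSequence_shortExact {A B : Type u} [AddCommGroup A] [Module T A] [AddCommGroup B]
    [Module S B] {x : T} (hx : IsSMulRegular A x) {g : A →ₛₗ[f] B}
    (hg : ∀ y, g y = 0 ↔ ∃ z, x • z = y) (hsurj : Function.Surjective g) :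
    (smulSequence f x g hg).ShortExact :=
  ModuleCat.shortComplex_shortExact _ hg hx hsurj

variable {f} in
theorem exists_map_restrictScalars_eq (hf : Function.Surjective f) {A B : ModuleCat.{u} S}
    (ψ : (ModuleCat.restrictScalars f).obj A ⟶ (ModuleCat.restrictScalars f).obj B) :
    ∃ φ : A ⟶ B, (ModuleCat.restrictScalars f).map φ = ψ := by
  refine ⟨ModuleCat.ofHom
    { toFun := fun y => ψ.hom y
      map_add' := fun y z => ψ.hom.map_add y z
      map_smul' := fun s y => ?_ }, rfl⟩
  obtain ⟨t, rfl⟩ := hf s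
  exact ψ.hom.map_smul t y

theorem smul_ext_eq_zero_of_mem_ker {x : T} (hx : f x = 0) (A : ModuleCat.{u} S)
    (M : ModuleCat.{u} T) (i : ℕ) (α : Ext ((ModuleCat.restrictScalars f).obj A) M i) :
    α.comp (Ext.mk₀ (x • 𝟙 M)) (add_zero i) = 0 := by
  have h : x • 𝟙 ((ModuleCat.restrictScalars f).obj A) = 0 := by
    ext y
    change f x • (y : A) = 0
    rw [hx, zero_smul]
  rw [Ext.mk₀_smul, Ext.comp_smul, Ext.comp_mk₀_id, ← Ext.mk₀_id_comp α, ← Ext.smul_comp,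
    ← Ext.mk₀_smul, h, Ext.mk₀_zero, Ext.zero_comp]

theorem hom_restrictScalars_eq_zero {x : T} (hx : f x = 0) (hreg : IsSMulRegular T x)
    (A : ModuleCat.{u} S) (φ : (ModuleCat.restrictScalars f).obj A ⟶ ModuleCat.of T T) :
    φ = 0 := by
  ext y
  apply hreg
  have h : x • (y : (ModuleCat.restrictScalars f).obj A) = 0 := by
    change f x • (y : A) = 0
    rw [hx, zero_smul]
  change x • φ.hom y = x • (0 : T)
  rw [← map_smul, h, map_zero, smul_zero]

/-- A ring homomorphism as a semilinear map. -/
abbrev ringHomSemilinear : T →ₛₗ[f] S where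
  toFun := f
  map_add' := map_add f
  map_smul' := map_mul f

/-- A ring homomorphism applied to the coordinates, as a semilinear map. -/
abbrev piSemilinear (n : ℕ) : (Fin n → T) →ₛₗ[f] (Fin n → S) where
  toFun := fun v i => f (v i)
  map_add' := fun _ _ => funext fun _ => map_add f _ _
  map_smul' := fun _ _ => funext fun _ => map_mul f _ _

variable {f}

/-- If the product with the class of 0 → T → T → S → 0 vanishes, φ lifts to T; but Hom_T(A, T) = 0
because `x` kills A and is regular on T. -/
theorem hom_eq_zero_of_comp_extClass {x : T} (hreg : IsSMulRegular T x)
    (hker : ∀ y, f y = 0 ↔ ∃ z, x • z = y)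
    (hE : (smulSequence f x (ringHomSemilinear f) hker).ShortExact) (A : ModuleCat.{u} S)
    (φ : (ModuleCat.restrictScalars f).obj A ⟶
      (ModuleCat.restrictScalars f).obj (ModuleCat.of S S))
    (h : (Ext.mk₀ φ).comp hE.extClass (zero_add 1) = 0) : φ = 0 := by
  obtain ⟨β, hβ⟩ := Ext.covariant_sequence_exact₃ _ hE (Ext.mk₀ φ) (zero_add 1) h
  obtain ⟨ψ, rfl⟩ := (Ext.mk₀_bijective _ _).2 β
  have hx : f x = 0 := (hker x).2 ⟨1, by simp⟩
  have hψ : ψ = 0 := hom_restrictScalars_eq_zero f hx hreg A ψ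
  rw [hψ, Ext.mk₀_zero, Ext.zero_comp] at hβ
  exact (Ext.mk₀_eq_zero_iff φ).1 hβ.symm

/-- Dimension shifting along a free cover over S. Degrees 0 and 1 are done by hand with the
connecting class; from degree 2 on, free S-modules contribute nothing, having projective dimension
at most one over T. -/
theorem subsingleton_ext_of_regular_element [IsNoetherianRing S] (hf : Function.Surjective f)
    {x : T} (hreg : IsSMulRegular T x) (hker : ∀ y, f y = 0 ↔ ∃ z, x • z = y) (i : ℕ) :
    ∀ (N : Type u) [AddCommGroup N] [Module S N] [Module.Finite S N],
      Subsingleton (Ext ((ModuleCat.restrictScalars f).obj (ModuleCat.of S N))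
        (ModuleCat.of T T) (i + 1)) →
      Subsingleton (Ext (ModuleCat.of S N) (ModuleCat.of S S) i) := by
  have hx : f x = 0 := (hker x).2 ⟨1, by simp⟩
  have hE := smulSequence_shortExact (f := f) hreg (g := ringHomSemilinear f) hker hf
  have hfree : ∀ n j : ℕ, Subsingleton (Ext ((ModuleCat.restrictScalars f).obj
      (ModuleCat.of S (Fin n → S))) (ModuleCat.of T T) (j + 2)) := by
    intro n j
    have hkern : ∀ y : Fin n → T, piSemilinear f n y = 0 ↔ ∃ z, x • z = y := by
      intro y
      constructor
      · intro hy
        choose z hz using fun i => (hker (y i)).1 (congrFun hy i)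
        exact ⟨z, funext hz⟩
      · rintro ⟨z, rfl⟩
        funext i
        exact (hker _).2 ⟨z i, rfl⟩
    have hregn : IsSMulRegular (Fin n → T) x := fun v w h =>
      funext fun i => hreg (congrFun h i)
    have hEn := smulSequence_shortExact (f := f) hregn (g := piSemilinear f n) hkern
      (fun v => ⟨fun i => (hf (v i)).choose, funext fun i => (hf (v i)).choose_spec⟩)
    have : Projective (ModuleCat.of T (Fin n → T)) :=
      ModuleCat.projective_of_free (Pi.basisFun T (Fin n))
    exact subsingleton_ext_left_X₃ hEn _ (j + 1) (Ext.subsingleton_of_projective _ _ _)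
      (Ext.subsingleton_of_projective _ _ _)
  induction i with
  | zero =>
    intro N _ _ _ h
    refine subsingleton_of_forall_eq_zero fun α => ?_
    obtain ⟨φ, rfl⟩ := (Ext.mk₀_bijective _ _).2 α
    have := hom_eq_zero_of_comp_extClass hreg hker hE (ModuleCat.of S N)
      ((ModuleCat.restrictScalars f).map φ) (h.elim _ _)
    rw [(ModuleCat.restrictScalars f).map_injective (this.trans
      ((ModuleCat.restrictScalars f).map_zero _ _).symm), Ext.mk₀_zero]
  | succ i ih =>
    intro N _ _ _ h
    obtain ⟨n, p, hp⟩ := Module.Finite.exists_fin' S N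
    have hS := LinearMap.shortExact_shortComplexKer hp
    have hS' := hS.map_of_exact (ModuleCat.restrictScalars f)
    have : Projective (ModuleCat.of S (Fin n → S)) :=
      ModuleCat.projective_of_free (Pi.basisFun S (Fin n))
    rcases i with _ | i
    · refine subsingleton_of_forall_eq_zero fun α => ?_
      obtain ⟨β, rfl⟩ := Ext.contravariant_sequence_exact₃ hS _ α
        (Ext.eq_zero_of_projective _) (add_zero 1)
      obtain ⟨φ, rfl⟩ := (Ext.mk₀_bijective _ _).2 β
      -- The product of φ with the extension class extends to γ on the free module. As `x`
      -- annihilates γ, γ is itself a product ψ · class, and injectivity of this product gives φ = ψ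
      -- restricted to the kernel; so α = 0.
      obtain ⟨γ, hγ⟩ := Ext.contravariant_sequence_exact₁ hS' _
        ((Ext.mk₀ ((ModuleCat.restrictScalars f).map φ)).comp hE.extClass (zero_add 1))
        rfl (h.elim _ _)
      obtain ⟨δ, hδ⟩ := Ext.covariant_sequence_exact₁ _ hE γ
        (smul_ext_eq_zero_of_mem_ker f hx _ _ _ γ) (zero_add 1)
      obtain ⟨ψ, rfl⟩ := (Ext.mk₀_bijective _ _).2 δ
      obtain ⟨ψ, rfl⟩ := exists_map_restrictScalars_eq hf ψ
      have hcomp : (Ext.mk₀ ((ModuleCat.restrictScalars f).map φ)).comp hE.extClass (zero_add 1) =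
          (Ext.mk₀ ((ModuleCat.restrictScalars f).map (p.shortComplexKer.f ≫ ψ))).comp
            hE.extClass (zero_add 1) := by
        refine hγ.symm.trans ?_
        rw [← hδ, Functor.map_comp]
        exact precomp_comp (M := ModuleCat.of T T) _ _ _
      have hzero := hom_eq_zero_of_comp_extClass hreg hker hE _
        ((ModuleCat.restrictScalars f).map (φ - p.shortComplexKer.f ≫ ψ)) (by
          rw [Functor.map_sub, sub_eq_add_neg, Ext.mk₀_add, Ext.mk₀_neg, Ext.add_comp,
            Ext.neg_comp, hcomp, add_neg_cancel])
      have hφ : φ = p.shortComplexKer.f ≫ ψ := by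
        rw [← sub_eq_zero]
        exact (ModuleCat.restrictScalars f).map_injective
          (hzero.trans ((ModuleCat.restrictScalars f).map_zero _ _).symm)
      rw [hφ, ← Ext.mk₀_comp_mk₀, hS.extClass_comp_assoc]
    · refine subsingleton_ext_left_X₃ hS _ (i + 1) (ih _ ?_)
        (Ext.subsingleton_of_projective _ _ _)
      exact subsingleton_ext_left_X₁ hS' _ (i + 2) (hfree n i) h

end ChangeOfRings

/-! ### Change of rings modulo a regular sequence -/

section ChangeOfRingsList

open Abelian RingTheory.Sequence Pointwise

theorem subsingleton_ext_of_bijective {T S : Type u} [CommRing T] [CommRing S] {f : T →+* S}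
    (hf : Function.Bijective f) (N : ModuleCat.{u} S) (i : ℕ)
    (h : Subsingleton (Ext ((ModuleCat.restrictScalars f).obj N) (ModuleCat.of T T) i)) :
    Subsingleton (Ext N (ModuleCat.of S S) i) := by
  have : (ModuleCat.restrictScalars.{u} f).IsEquivalence :=
    ModuleCat.restrictScalars_isEquivalence_of_ringEquiv (RingEquiv.ofBijective f hf)
  have hinj := ((ModuleCat.restrictScalars.{u} f).mapExt_bijective_of_preservesProjectiveObjects N
    (ModuleCat.of S S) i).injective
  let e : T ≃ₗ[T] (ModuleCat.restrictScalars.{u} f).obj (ModuleCat.of S S) :=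
    LinearEquiv.ofBijective (σ₁₂ := RingHom.id T)
      (M₂ := (ModuleCat.restrictScalars.{u} f).obj (ModuleCat.of S S))
      { toFun := fun t => (f t : S)
        map_add' := map_add f
        map_smul' := map_mul f } hf
  have := subsingleton_ext_right_of_iso e.toModuleIso _ i h
  exact hinj.subsingleton

theorem finite_restrictScalars {T S : Type u} [CommRing T] [CommRing S] {f : T →+* S}
    (hf : Function.Surjective f) (N : Type u) [AddCommGroup N] [Module S N] [Module.Finite S N] :
    Module.Finite T ((ModuleCat.restrictScalars f).obj (ModuleCat.of S N)) := by
  obtain ⟨n, p, hp⟩ := Module.Finite.exists_fin' S N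
  let q : (Fin n → T) →ₗ[T] (ModuleCat.restrictScalars f).obj (ModuleCat.of S N) :=
    { toFun := fun v => p (piSemilinear f n v)
      map_add' := fun v w => by rw [map_add, map_add]; rfl
      map_smul' := fun t v => by rw [map_smulₛₗ, map_smul]; rfl }
  refine Module.Finite.of_surjective q fun y => ?_
  obtain ⟨v, rfl⟩ := hp y
  choose w hw using fun i => hf (v i)
  exact ⟨w, congrArg p (funext hw)⟩

/-- The ring T varies in the induction: the first element is divided out, and the remaining ones
form a weakly regular sequence in T/x with the same final quotient S. -/
theorem subsingleton_ext_of_weaklyRegular_sequence {S : Type u} [CommRing S] [IsNoetherianRing S]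
    (N : Type u) [AddCommGroup N] [Module S N] [Module.Finite S N] (i : ℕ) (n : ℕ) :
    ∀ {T : Type u} [CommRing T] [IsNoetherianRing T] {f : T →+* S} {xs : List T},
      xs.length = n → Function.Surjective f → RingHom.ker f = Ideal.ofList xs →
      IsWeaklyRegular T xs →
      Subsingleton (Ext ((ModuleCat.restrictScalars f).obj (ModuleCat.of S N))
        (ModuleCat.of T T) (i + n)) →
      Subsingleton (Ext (ModuleCat.of S N) (ModuleCat.of S S) i) := by
  induction n with
  | zero =>
    intro T _ _ f xs hn hf hker _ h
    rw [List.length_eq_zero_iff.1 hn, Ideal.ofList_nil] at hker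
    exact subsingleton_ext_of_bijective ⟨(RingHom.injective_iff_ker_eq_bot f).2 hker, hf⟩ _ i h
  | succ n ih =>
    intro T _ _ f xs hn hf hker hreg h
    obtain _ | ⟨x, xs⟩ := xs
    · simp at hn
    have hx : ∀ y ∈ Ideal.span {x}, f y = 0 := by
      intro y hy
      rw [← RingHom.mem_ker, hker, Ideal.ofList_cons]
      exact Ideal.mem_sup_left hy
    let g := Ideal.Quotient.lift (Ideal.span {x}) f hx
    have hg : Function.Surjective g := Ideal.Quotient.lift_surjective_of_surjective _ hx hf
    rw [isWeaklyRegular_cons_iff'] at hreg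
    refine ih (f := g) (xs := xs.map (Ideal.Quotient.mk (Ideal.span {x}))) (by simpa using hn)
      hg ?_ ?_ ?_
    · rw [← Ideal.map_ofList]
      refine (Ideal.ker_quotient_lift f hx).trans ?_
      rw [ hker, Ideal.ofList_cons, Ideal.map_sup,
        Ideal.map_quotient_self, bot_sup_eq]
    · let e : QuotSMulTop x T ≃ₗ[T] (T ⧸ Ideal.span {x}) :=
        Submodule.quotEquivOfEq _ _ (by
          rw [← Submodule.ideal_span_singleton_smul, smul_eq_mul, Ideal.mul_top])
      have h1 := (isWeaklyRegular_map_algebraMap_iff (T ⧸ Ideal.span {x}) _ xs).1 hreg.2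
      exact (isWeaklyRegular_map_algebraMap_iff (T ⧸ Ideal.span {x}) (T ⧸ Ideal.span {x}) xs).2
        ((LinearEquiv.isWeaklyRegular_congr e xs).1 h1)
    · have : Module.Finite (T ⧸ Ideal.span {x})
          ((ModuleCat.restrictScalars g).obj (ModuleCat.of S N)) :=
        finite_restrictScalars hg N
      refine subsingleton_ext_of_regular_element (f := Ideal.Quotient.mk (Ideal.span {x}))
        Ideal.Quotient.mk_surjective hreg.1 ?_ (i + n)
        ((ModuleCat.restrictScalars g).obj (ModuleCat.of S N)) h
      intro y
      rw [Ideal.Quotient.eq_zero_iff_mem, Ideal.mem_span_singleton']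
      simp only [smul_eq_mul, mul_comm x]

end ChangeOfRingsList

/-! ### Faithfully flat descent of Ext vanishing -/

section FlatDescent

open Abelian TensorProduct

variable {R : Type u} [CommRing R] (S : Type u) [CommRing S] [Algebra R S]
  [Module.FaithfullyFlat R S]

/-- Hom out of a finitely presented module commutes with flat base change, and faithful flatness
reflects surjectivity. -/
theorem lcomp_surjective_of_baseChange {K F M : Type u} [AddCommGroup K] [Module R K]
    [AddCommGroup F] [Module R F] [AddCommGroup M] [Module R M] [Module.FinitePresentation R K]
    [Module.FinitePresentation R F] (f : K →ₗ[R] F)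
    (h : Function.Surjective ((f.baseChange S).lcomp S (S ⊗[R] M))) :
    Function.Surjective (f.lcomp R M) := by
  let eF := (Module.FinitePresentation.isBaseChange_map R F M S).equiv
  let eK := (Module.FinitePresentation.isBaseChange_map R K M S).equiv
  have hcomm : ∀ y, eK ((f.lcomp R M).lTensor S y) = (f.baseChange S).lcomp S (S ⊗[R] M) (eF y) := by
    intro y
    induction y with
    | zero => simp
    | add y z hy hz => simp only [map_add, hy, hz]
    | tmul s φ =>
      ext k
      simp [eK, eF, IsBaseChange.equiv_tmul]
  rw [← Module.FaithfullyFlat.lTensor_surjective_iff_surjective R S]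
  intro y
  obtain ⟨z, hz⟩ := h (eK y)
  refine ⟨eF.symm z, eK.injective ?_⟩
  rw [hcomm, eF.apply_symm_apply, hz]

/-- Degree 0 is descent for Hom, degree 1 is descent for surjectivity of Hom(F, M) → Hom(K, M) with
F a free cover, and higher degrees follow by dimension shifting. -/
theorem subsingleton_ext_of_baseChange [IsNoetherianRing R] (M : Type u) [AddCommGroup M]
    [Module R M] (i : ℕ) : ∀ (N : Type u) [AddCommGroup N] [Module R N] [Module.Finite R N],
      Subsingleton (Ext (ModuleCat.of S (S ⊗[R] N)) (ModuleCat.of S (S ⊗[R] M)) i) →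
      Subsingleton (Ext (ModuleCat.of R N) (ModuleCat.of R M) i) := by
  induction i with
  | zero =>
    intro N _ _ _ h
    have hS : Subsingleton (S ⊗[R] N →ₗ[S] S ⊗[R] M) :=
      ⟨fun φ ψ => congrArg ModuleCat.Hom.hom ((Ext.mk₀_bijective _ _).1
        (h.elim (Ext.mk₀ (ModuleCat.ofHom φ)) (Ext.mk₀ (ModuleCat.ofHom ψ))))⟩
    have := Module.finitePresentation_of_finite R N
    have : Subsingleton (S ⊗[R] (N →ₗ[R] M)) :=
      (Module.FinitePresentation.isBaseChange_map R N M S).equiv.injective.subsingleton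
    have := Module.FaithfullyFlat.lTensor_reflects_triviality R S (N →ₗ[R] M)
    refine subsingleton_of_forall_eq_zero fun α => ?_
    obtain ⟨φ, rfl⟩ := (Ext.mk₀_bijective _ _).2 α
    rw [show φ = 0 from ModuleCat.hom_ext (Subsingleton.elim _ _), Ext.mk₀_zero]
  | succ i ih =>
    intro N _ _ _ h
    obtain ⟨n, p, hp⟩ := Module.Finite.exists_fin' R N
    have hE := LinearMap.shortExact_shortComplexKer hp
    have : Projective (ModuleCat.of R (Fin n → R)) :=
      ModuleCat.projective_of_free (Pi.basisFun R (Fin n))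
    have : Projective (ModuleCat.of S (S ⊗[R] (Fin n → R))) :=
      ModuleCat.projective_of_free ((Pi.basisFun R (Fin n)).baseChange S)
    have hexact : Function.Exact (LinearMap.ker p).subtype p :=
      LinearMap.exact_subtype_ker_map p
    have hE' := shortExact_of_exact (f := (LinearMap.ker p).subtype.baseChange S)
      (g := p.baseChange S)
      (Module.Flat.lTensor_preserves_injective_linearMap _ (LinearMap.ker p).injective_subtype)
      (LinearMap.lTensor_surjective S hp) (lTensor_exact S hexact hp)
    rcases i with _ | i
    · have := Module.finitePresentation_of_finite R (LinearMap.ker p)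
      have hsurj : Function.Surjective ((LinearMap.ker p).subtype.lcomp R M) := by
        refine lcomp_surjective_of_baseChange S _ fun φ => ?_
        obtain ⟨α, hα⟩ := Ext.contravariant_sequence_exact₁ hE' _ (Ext.mk₀ (ModuleCat.ofHom φ)) rfl
          (h.elim _ _)
        obtain ⟨ψ, rfl⟩ := (Ext.mk₀_bijective _ _).2 α
        rw [Ext.mk₀_comp_mk₀] at hα
        exact ⟨ψ.hom, congrArg ModuleCat.Hom.hom ((Ext.mk₀_bijective _ _).1 hα)⟩
      refine subsingleton_of_forall_eq_zero fun α => ?_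
      obtain ⟨β, rfl⟩ := Ext.contravariant_sequence_exact₃ hE _ α
        (Ext.eq_zero_of_projective _) (add_zero 1)
      obtain ⟨φ, rfl⟩ := (Ext.mk₀_bijective _ _).2 β
      obtain ⟨ψ, hψ⟩ := hsurj φ.hom
      have : φ = p.shortComplexKer.f ≫ ModuleCat.ofHom ψ := ModuleCat.hom_ext hψ.symm
      rw [this, ← Ext.mk₀_comp_mk₀, hE.extClass_comp_assoc]
    · exact subsingleton_ext_left_X₃ hE _ (i + 1)
        (ih _ (subsingleton_ext_left_X₁ hE' _ (i + 1) (Ext.subsingleton_of_projective _ _ _) h))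
        (Ext.subsingleton_of_projective _ _ _)

end FlatDescent

/-! ### Descent from the adic completion -/

section Completion

variable {R : Type u} [CommRing R] [IsNoetherianRing R] {a : Ideal R}

/-- Each maximal ideal m contains `a`, so the completion maps onto R/a and then R/m; this map kills
the extension of m but not 1. -/
theorem faithfullyFlat_adicCompletion (ha : a ≤ (⊥ : Ideal R).jacobson) :
    Module.FaithfullyFlat R (AdicCompletion a R) where
  submodule_ne_top m hm h := by
    have ham : a ≤ m := ha.trans (sInf_le ⟨bot_le, hm⟩)
    let φ : AdicCompletion a R →+* R ⧸ m :=
      (Ideal.Quotient.factor ham).comp (AdicCompletion.evalOneₐ a : AdicCompletion a R →+* R ⧸ a)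
    have hφ : ∀ r, φ (algebraMap R _ r) = Ideal.Quotient.mk m r := by
      intro r
      simp only [φ, RingHom.comp_apply, RingHom.coe_coe, AlgHom.commutes]
      rfl
    have h1 : (1 : AdicCompletion a R) ∈ m • (⊤ : Submodule R (AdicCompletion a R)) := by
      rw [h]
      exact Submodule.mem_top
    have hker : ∀ y ∈ m • (⊤ : Submodule R (AdicCompletion a R)), φ y = 0 := by
      intro y hy
      refine Submodule.smul_induction_on hy (fun r hr y _ => ?_) fun y z hy hz => ?_
      · rw [Algebra.smul_def, map_mul, hφ, Ideal.Quotient.eq_zero_iff_mem.2 hr, zero_mul]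
      · rw [map_add, hy, hz, add_zero]
    have : Nontrivial (R ⧸ m) := Ideal.Quotient.nontrivial_iff.2 hm.ne_top
    exact one_ne_zero ((map_one φ).symm.trans (hker 1 h1))

open Abelian in
theorem subsingleton_ext_of_adicCompletion (ha : a ≤ (⊥ : Ideal R).jacobson) (i : ℕ)
    (h : Subsingleton (Ext (ModuleCat.of (AdicCompletion a R)
      (AdicCompletion a R ⧸ a.map (algebraMap R (AdicCompletion a R))))
      (ModuleCat.of (AdicCompletion a R) (AdicCompletion a R)) i)) :
    Subsingleton (Ext (ModuleCat.of R (R ⧸ a)) (ModuleCat.of R R) i) := by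
  have := faithfullyFlat_adicCompletion ha
  refine subsingleton_ext_of_baseChange (AdicCompletion a R) R i (R ⧸ a) ?_
  refine subsingleton_ext_left_of_iso
    (Algebra.TensorProduct.quotIdealMapEquivTensorQuot (AdicCompletion a R)
      a).toLinearEquiv.toModuleIso _ i ?_
  exact subsingleton_ext_right_of_iso
    (TensorProduct.AlgebraTensorModule.rid R (AdicCompletion a R)
      (AdicCompletion a R)).symm.toModuleIso _ i h

end Completion

/-! ### Complete intersection implies Gorenstein -/

section CompleteIntersection

open Abelian RingTheory.Sequence

variable {R : Type u} [CommRing R] [IsNoetherianRing R] {a : Ideal R}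

/-- Generators up to radical are approximated by elements of R modulo a^(N+1). The error lies in a ·
a^N, so Nakayama still gives a^N ≤ (l). -/
theorem exists_list_radical_eq_of_adicCompletion (ha : a ≤ (⊥ : Ideal R).jacobson)
    {zs : List (AdicCompletion a R)} {N : ℕ}
    (hzs : Ideal.ofList zs ≤ a.map (algebraMap R (AdicCompletion a R)))
    (hN : a.map (algebraMap R (AdicCompletion a R)) ^ N ≤ Ideal.ofList zs) :
    ∃ l : List R, l.length = zs.length ∧ (Ideal.ofList l).radical = a.radical := by
  let q : AdicCompletion a R →+* R ⧸ a ^ (N + 1) :=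
    (AdicCompletion.evalₐ a (N + 1) : AdicCompletion a R →+* R ⧸ a ^ (N + 1))
  have hq : q.comp (algebraMap R (AdicCompletion a R)) = Ideal.Quotient.mk (a ^ (N + 1)) :=
    RingHom.ext fun r => (AdicCompletion.evalₐ a (N + 1)).commutes r
  choose lift hlift using Ideal.Quotient.mk_surjective (I := a ^ (N + 1))
  let l := zs.map fun z => lift (q z)
  have hl : (Ideal.ofList l).map (Ideal.Quotient.mk (a ^ (N + 1))) = (Ideal.ofList zs).map q := by
    rw [Ideal.map_ofList, Ideal.map_ofList, List.map_map]
    congr 1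
    exact List.map_congr_left fun z _ => hlift (q z)
  have hcomap : ∀ J : Ideal R, (J.map (Ideal.Quotient.mk (a ^ (N + 1)))).comap
      (Ideal.Quotient.mk (a ^ (N + 1))) = J ⊔ a ^ (N + 1) := by
    intro J
    rw [Ideal.comap_map_of_surjective' _ Ideal.Quotient.mk_surjective, Ideal.mk_ker]
  have hla : Ideal.ofList l ≤ a := by
    have h := Ideal.map_mono (f := q) hzs
    rw [← hl, Ideal.map_map, hq, Ideal.map_le_iff_le_comap, hcomap] at h
    exact h.trans (sup_le le_rfl (Ideal.pow_le_self N.succ_ne_zero))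
  have hle : a ^ N ≤ Ideal.ofList l := by
    have h := Ideal.map_mono (f := q) hN
    rw [← hl, ← Ideal.map_pow, Ideal.map_map, hq, Ideal.map_le_iff_le_comap, hcomap, pow_succ'] at h
    exact Submodule.le_of_le_smul_of_le_jacobson_bot (IsNoetherian.noetherian _) ha h
  refine ⟨l, List.length_map _, le_antisymm (Ideal.radical_mono hla) ?_⟩
  rw [Ideal.radical_le_radical_iff]
  exact fun x hx => ⟨N, hle (Ideal.pow_mem_pow hx N)⟩

/-- The residue ring of a surjective ring homomorphism modulo the extension of an ideal that
contains the kernel. -/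
def quotientIsoRestrictScalars {T S : Type u} [CommRing T] [CommRing S] {f : T →+* S}
    (hf : Function.Surjective f) {b : Ideal T} (hb : RingHom.ker f ≤ b) :
    ModuleCat.of T (T ⧸ b) ≅ (ModuleCat.restrictScalars f).obj (ModuleCat.of S (S ⧸ b.map f)) :=
  let q : T →ₗ[T] (ModuleCat.restrictScalars f).obj (ModuleCat.of S (S ⧸ b.map f)) :=
    { toFun := fun t => (Ideal.Quotient.mk (b.map f) (f t) : S ⧸ b.map f)
      map_add' := fun s t => by rw [map_add, map_add]; rfl
      map_smul' := fun s t => by rw [smul_eq_mul, map_mul, map_mul]; rfl }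
  have hker : b = LinearMap.ker q := by
    ext t
    change t ∈ b ↔ Ideal.Quotient.mk (b.map f) (f t) = 0
    rw [Ideal.Quotient.eq_zero_iff_mem, ← Ideal.mem_comap, Ideal.comap_map_of_surjective' f hf,
      sup_eq_left.2 hb]
  ((Submodule.quotEquivOfEq _ _ hker).trans (q.quotKerEquivOfSurjective
    (Ideal.Quotient.mk_surjective.comp hf))).toModuleIso

theorem IsRelCompleteIntersection.isRelGorenstein (ha : a ≠ ⊤) (haj : a ≤ (⊥ : Ideal R).jacobson)
    (h : IsRelCompleteIntersection R a) : IsRelGorenstein a R := by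
  obtain ⟨T, _, _, b, xs, e, hb, hxs, ⟨ys, -, hmem, hlen, hrad⟩, hreg, hT, hmap⟩ := h
  obtain hT | ⟨-, rs, rfl, hrs, hrsreg, -⟩ := hT
  · exact absurd (by simpa using hT) hb
  let f : T →+* AdicCompletion a R := (e : (T ⧸ Ideal.ofList xs) →+* AdicCompletion a R).comp
    (Ideal.Quotient.mk (Ideal.ofList xs))
  have hf : Function.Surjective f := e.surjective.comp Ideal.Quotient.mk_surjective
  have hker : RingHom.ker f = Ideal.ofList xs := by
    ext t
    rw [RingHom.mem_ker, ← Ideal.Quotient.eq_zero_iff_mem]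
    exact e.map_eq_zero_iff
  have hxsb : Ideal.ofList xs ≤ Ideal.ofList rs := Ideal.span_le.2 hxs
  -- Concentration of Ext_T(T/b, T) in degree |rs|, carried to the completion by change of rings and
  -- then down to R.
  have hvanish : ∀ i, i + xs.length ≠ rs.length →
      Subsingleton (Ext (ModuleCat.of R (R ⧸ a)) (ModuleCat.of R R) i) := by
    intro i hi
    refine subsingleton_ext_of_adicCompletion haj i ?_
    rw [← hmap]
    exact subsingleton_ext_of_weaklyRegular_sequence _ i xs.length rfl hf hker hreg.1
      (subsingleton_ext_left_of_iso (quotientIsoRestrictScalars hf (hker.trans_le hxsb)) _ _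
        (subsingleton_ext_quotient_ofList hrsreg hi))
  have hcd : cd a R ≤ (ys.length : WithBot ℕ∞) := by
    have hann : Module.annihilator T T = ⊥ := Module.annihilator_eq_bot.2 inferInstance
    rw [hann, sup_bot_eq, sup_bot_eq] at hrad
    obtain ⟨N, hN⟩ := Ideal.exists_pow_le_of_le_radical_of_fg
      (Ideal.le_radical.trans hrad.ge) (IsNoetherian.noetherian (Ideal.ofList rs))
    -- The elements `xs` die in the completion, so the images of `ys` alone generate the extension
    -- of `a` up to radical.
    have hmapxs : (Ideal.ofList (xs ++ ys)).map f = Ideal.ofList (ys.map f) := by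
      rw [Ideal.ofList_append, Ideal.map_sup, (Ideal.map_eq_bot_iff_le_ker f).2 hker.ge, bot_sup_eq,
        Ideal.map_ofList]
    obtain ⟨l, hl, hlrad⟩ := exists_list_radical_eq_of_adicCompletion haj (zs := ys.map f) (N := N)
      (by
        rw [← hmapxs, ← hmap]
        exact Ideal.map_mono (Ideal.span_le.2 hmem))
      (by
        rw [← hmapxs, ← hmap, ← Ideal.map_pow]
        exact Ideal.map_mono hN)
    rw [List.length_map] at hl
    rw [← hl]
    exact cd_le_length hlrad R
  have hsum : xs.length + ys.length = rs.length := by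
    rw [← hrs, List.length_append] at hlen
    exact_mod_cast hlen
  have htop : a • (⊤ : Submodule R R) ≠ ⊤ := by simpa using ha
  obtain ⟨g, hg, hnt, -⟩ := exists_grade_eq a R htop
  -- Ext is nonzero in degree g, and `hvanish` leaves only one such degree.
  have hgeq : g + xs.length = rs.length := by
    by_contra hne
    exact not_subsingleton_iff_nontrivial.2 hnt (hvanish g hne)
  have hcdg : cd a R = g := by
    refine le_antisymm (by rwa [show g = ys.length by omega]) ?_
    have := grade_le_cd a R htop
    rwa [hg] at this
  intro i hi
  refine hvanish i fun hne => hi ?_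
  rw [hcdg, show i = g by omega]

end CompleteIntersection

end RelHom

end

theorem theorem2p19 {R : Type u} [CommRing R] [IsNoetherianRing R] (a : Ideal R) (ha : a ≠ ⊤) :
    (a ≤ (⊥ : Ideal R).jacobson →
      RelHom.IsRelRegular a R → RelHom.IsRelCompleteIntersection R a) ∧
    (a ≤ (⊥ : Ideal R).jacobson →
      RelHom.IsRelCompleteIntersection R a → RelHom.IsRelGorenstein a R) ∧
    (∀ (M : Type u) [AddCommGroup M] [Module R M] [Module.Finite R M],
      a • (⊤ : Submodule R M) ≠ ⊤ →
        RelHom.IsRelGorenstein a M → RelHom.IsRelMaximalCohenMacaulay a M) ∧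
    (∀ (M : Type u) [AddCommGroup M] [Module R M] [Module.Finite R M],
      RelHom.IsRelMaximalCohenMacaulay a M → RelHom.IsRelCohenMacaulay a M) := by
  refine ⟨fun _ h => h.isRelCompleteIntersection ha, fun haj h => h.isRelGorenstein ha haj, ?_, ?_⟩
  · intro M _ _ _ hM h
    exact h.isRelMaximalCohenMacaulay hM
  · intro M _ _ _ h
    exact h.isRelCohenMacaulay
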